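/- Let $n\ge 4$, let $K$ be a field, and let $G=K_{2,n-2}$ be the complete bipartite graph on the vertex set $V=\{1,2\}\cup\{3,\dots,n\}$, with edge set $E$. For an unordered partition $A|B$ of $V$ ($A\cap B=\emptyset$, $A\cup B=V$, parts may be empty) let $\delta_{A|B}\in\{0,1\}^E$ be the vector whose coordinate at $e$ is $1$ if and only if $|A\cap e|=1$, and let $P=\mathrm{Cut}(G)\subset\mathbb R^E$ be the convex hull of all $\delta_{A|B}$; put $d=\dim P$. Let $\mathcal A_P$ be the set of vectors $(a,1)$ with $a\in P\cap\mathbb Z^E$ (these $a$ are exactly the vectors $\delta_{A|B}$), let $\mathbb Z\mathcal A_P$ be the lattice it spans, and let $i(P,m)=|m\,\mathrm{conv}(\mathcal A_P)\cap\mathbb Z\mathcal A_P|$. The $h^*$-polynomial of $P$ in the lattice $\mathbb Z\mathcal A_P$ is defined by $1+\sum_{m\ge1}i(P,m)x^m=h^*(P,x)/(1-x)^{d+1}$. Normalized volumes are taken with respect to $\mathbb Z\mathcal A_P$: the normalized volume of a set $S\subset\mathbb R^E$ is $|E|!$ times its Lebesgue measure, divided by the covolume of $\{v\in\mathbb R^E: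 (v,0)\in\mathbb Z\mathcal A_P\}$. In the polynomial ring $K[q]$ with one variable $q_{A|B}$ for each unordered partition of $V$, let $I$ be the toric ideal of $\mathcal A_P$, i.e. the kernel of the homomorphism $q_{A|B}\mapsto \mathbf t^{(\delta_{A|B},1)}$ to the Laurent polynomial ring. Let $<$ be any (graded) reverse lexicographic order on $K[q]$ whose order of the variables satisfies $q_{A|B}<q_{C|D}$ whenever $\min\{|A|,|B|\}<\min\{|C|,|D|\}$. Let $\Delta$ be the initial complex $$\Delta=\Delta(\mathrm{in}_<(I))=\Big\{\mathrm{conv}\{\delta_{A|B}: A|B\in S\} \;:\; \prod_{A|B\in S}q_{A|B}\notin\sqrt{\mathrm{in}_<(I)}\Big\},$$ where $S$ ranges over the sets of unordered partitions of $V$, and let $h_\Delta(x)=\sum_{i=0}^{d+1}f_{i-1}x^i(1-x)^{d+1-i}$ be its $h$-polynomial, where $f_{-1}=1$ and $f_i$ is the number of $i$-dimensional faces of $\Delta$. Theorem. $\Delta$ is a unimodular triangulation of $P$ (a triangulation with vertices in $P\cap\mathbb Z^E$ all of whose maximal simplices have normalized volume $1$), and $$h^*(P,x)=h_\Delta(x)=(x+1)\,\big(A_{n-2}(x)\big)^2,$$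 where $A_k(x)=\sum_{w\in\mathfrak S_k}x^{\mathrm{des}(w)}$ is the Eulerian polynomial, with $\mathrm{des}(w)=|\{i : w_i>w_{i+1}\}|$. In particular, the normalized volume of $P$ is $h^*(P,1)=2\,((n-2)!)^2$. -/

import Mathlib

open Polynomial

noncomputable section

/-! ### Lattice polytopes, normalized Ehrhart function and `h*`-polynomial -/

namespace LatticePolytope

variable {ι : Type*}

/-- The points of `P` with integer coordinates. -/
def latticePoints (P : Set (ι → ℝ)) : Set (ι → ℝ) :=
  {x | x ∈ P ∧ ∀ i, ∃ z : ℤ, x i = z}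

/-- The columns `(a, 1)` of the configuration `𝒜_P`, where `a` runs over the lattice points
of `P`. -/
def columns (P : Set (ι → ℝ)) : Set ((ι → ℝ) × ℝ) :=
  (fun a => (a, (1 : ℝ))) '' latticePoints P

/-- The lattice `ℤ𝒜_P` spanned by the columns `(a, 1)`. -/
def columnLattice (P : Set (ι → ℝ)) : Submodule ℤ ((ι → ℝ) × ℝ) :=
  Submodule.span ℤ (columns P)

/-- The normalized Ehrhart function `i(P, m) = |m P' ∩ ℤ𝒜_P|`, where `P'` is the convex hull of
the columns `(a, 1)`. -/
def ehrhart (P : Set (ι → ℝ)) (m : ℕ) : ℕ :=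
  (((fun x => (m : ℝ) • x) '' convexHull ℝ (columns P)) ∩
    (columnLattice P : Set ((ι → ℝ) × ℝ))).ncard

/-- The dimension of (the affine hull of) a subset of `ℝ^ι`. -/
def dim (S : Set (ι → ℝ)) : ℕ :=
  Module.finrank ℝ (vectorSpan ℝ S)

/-- The `h*`-polynomial of `P` in the lattice `ℤ𝒜_P`, as the formal power series
`(1 - x) ^ (d + 1) * (1 + ∑_{m ≥ 1} i(P, m) x ^ m)` with `d = dim P`. -/
def hStar (P : Set (ι → ℝ)) : PowerSeries ℤ :=
  (1 - PowerSeries.X) ^ (dim P + 1) *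
    PowerSeries.mk fun m => if m = 0 then 1 else (ehrhart P m : ℤ)

/-- The lattice `ℤ𝒜_P` at height zero: the vectors `v` with `(v, 0) ∈ ℤ𝒜_P`. -/
def heightZeroLattice (P : Set (ι → ℝ)) : Submodule ℤ (ι → ℝ) :=
  (columnLattice P).comap (LinearMap.inl ℤ (ι → ℝ) ℝ)

/-- The normalized volume of `S ⊆ ℝ^d` with respect to a full rank lattice `L` of `ℝ^d`: `d!` times
the Lebesgue measure of `S`, in units in which a fundamental domain of `L` has measure `1`. -/
def normalizedVolumeIn [Fintype ι] (L : Submodule ℤ (ι → ℝ)) (S : Set (ι → ℝ)) : ℝ :=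
  ((Fintype.card ι).factorial : ℝ) * MeasureTheory.volume.real S / ZLattice.covolume L

/-- The normalized volume of a full-dimensional lattice polytope `P` with respect to the lattice
`ℤ𝒜_P`. -/
def normalizedVolume [Fintype ι] (P : Set (ι → ℝ)) : ℝ :=
  normalizedVolumeIn (heightZeroLattice P) P

/-- `Δ`, a set of convex sets that contains the empty face, is a triangulation of `P`: its nonempty
members are the simplices of a geometric simplicial complex whose vertices are lattice points
of `P` and whose union is `P`.  It is unimodular: each maximal simplex has normalized volume `1`
with respect to the lattice `ℤ𝒜_P`. -/
def IsUnimodularTriangulation [Fintype ι] (P : Set (ι → ℝ)) (Δ : Set (Set (ι → ℝ))) : Prop :=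
  ∃ K : Geometry.SimplicialComplex ℝ (ι → ℝ),
    Δ = insert ∅ ((fun s : Finset (ι → ℝ) => convexHull ℝ (s : Set (ι → ℝ))) '' K.faces) ∧
    K.vertices ⊆ latticePoints P ∧
    K.space = P ∧
    ∀ s ∈ K.facets,
      normalizedVolumeIn (heightZeroLattice P) (convexHull ℝ (s : Set (ι → ℝ))) = 1

/-- `faceNumber Δ i` is the number `f_{i-1}` of `(i-1)`-dimensional faces of `Δ`, with
`f_{-1} = 1`. -/
def faceNumber (Δ : Set (Set (ι → ℝ))) : ℕ → ℕ
  | 0 => 1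
  | i + 1 => {F | F ∈ Δ ∧ F.Nonempty ∧ dim F = i}.ncard

/-- The `h`-polynomial `∑_{i=0}^{d+1} f_{i-1} x^i (1-x)^{d+1-i}` of a triangulation `Δ` of `P`,
with `d = dim P`. -/
def hPolynomial (P : Set (ι → ℝ)) (Δ : Set (Set (ι → ℝ))) : ℤ[X] :=
  ∑ i ∈ Finset.range (dim P + 2),
    (faceNumber Δ i : ℤ[X]) * X ^ i * (1 - X) ^ (dim P + 1 - i)

end LatticePolytope

/-! ### The (graded) reverse lexicographic order -/

/-- The monomials in the variables `σ`, to be ordered by the reverse lexicographic order. -/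
def DegRevLex (σ : Type*) : Type _ := σ →₀ ℕ

namespace DegRevLex

variable {σ : Type*}

instance : AddCommMonoid (DegRevLex σ) := inferInstanceAs (AddCommMonoid (σ →₀ ℕ))

/-- The identity map from the monomials to `DegRevLex σ`. -/
def ofMonomial : (σ →₀ ℕ) ≃+ DegRevLex σ := AddEquiv.refl (σ →₀ ℕ)

/-- The comparison key of a monomial: first the total degree, then the negated exponents, the
smallest variable being compared first. -/
def keyOf (u : σ →₀ ℕ) : ℕ ×ₗ Lex (σ → ℤ) :=
  toLex (u.degree, toLex fun i => -(u i : ℤ))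

/-- The comparison key. -/
def key (u : DegRevLex σ) : ℕ ×ₗ Lex (σ → ℤ) := keyOf (ofMonomial.symm u)

theorem keyOf_injective : Function.Injective (keyOf (σ := σ)) := by
  intro u v h
  have h2 := congrArg (fun x => ofLex (ofLex x).2) h
  refine Finsupp.ext fun i => ?_
  have := congrFun h2 i
  simpa [keyOf] using this

theorem key_injective : Function.Injective (key (σ := σ)) :=
  keyOf_injective.comp ofMonomial.symm.injective

theorem keyOf_add (u v : σ →₀ ℕ) : keyOf (u + v) = keyOf u + keyOf v := by
  refine congrArg toLex (Prod.ext (map_add Finsupp.degree u v) ?_)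
  refine congrArg toLex (funext fun i => ?_)
  change -(((u + v) i : ℕ) : ℤ) = -(u i : ℤ) + -(v i : ℤ)
  rw [Finsupp.add_apply]
  push_cast
  ring

theorem key_add (u v : DegRevLex σ) : key (u + v) = key u + key v := by
  rw [key, map_add, keyOf_add]
  rfl

variable [LinearOrder σ] [Finite σ]

instance : LinearOrder (DegRevLex σ) :=
  LinearOrder.lift' key key_injective

theorem lt_iff_key {u v : DegRevLex σ} : u < v ↔ key u < key v := Iff.rfl

theorem le_iff_key {u v : DegRevLex σ} : u ≤ v ↔ key u ≤ key v := Iff.rfl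

instance : IsOrderedAddMonoid (DegRevLex σ) where
  add_le_add_left a b h c := by
    rw [le_iff_key, Prod.Lex.le_iff] at h ⊢
    rw [key_add, key_add]
    rcases h with h | ⟨h1, h2⟩
    · exact Or.inl (Nat.add_lt_add_right h _)
    · refine Or.inr ⟨congrArg (· + _) h1, ?_⟩
      exact add_le_add_left h2 _

theorem monotone_ofMonomial : Monotone (ofMonomial (σ := σ)) := by
  intro u v h
  rw [le_iff_key, Prod.Lex.le_iff]
  rcases (Finsupp.degree_mono h).lt_or_eq with hd | hd
  · exact Or.inl hd
  · refine Or.inr ⟨hd, le_of_eq ?_⟩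
    have : u = v := by
      obtain ⟨w, rfl⟩ := exists_add_of_le h
      rw [map_add] at hd
      have : Finsupp.degree w = 0 := by omega
      rw [Finsupp.degree_eq_zero_iff] at this
      simp [this]
    rw [this]

instance : WellFoundedLT (DegRevLex σ) := by
  have hp := Set.isPWO_of_wellQuasiOrderedLE (Set.univ : Set (σ →₀ ℕ))
  have h2 := (hp.image_of_monotone (monotone_ofMonomial (σ := σ))).isWF
  rw [Set.image_univ, ofMonomial.surjective.range_eq] at h2
  exact Set.isWF_univ_iff.mp h2

end DegRevLex

/-- The (graded) reverse lexicographic order on the monomials in the variables `σ`, for the given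
linear order of the variables. -/
def degRevLex (σ : Type*) [LinearOrder σ] [Finite σ] : MonomialOrder σ where
  syn := DegRevLex σ
  toSyn := DegRevLex.ofMonomial
  toSyn_monotone := DegRevLex.monotone_ofMonomial

/-- The usual description of the order: `u < v` if `deg u < deg v`, or if `deg u = deg v` and the
smallest variable whose exponents in `u` and `v` differ has the larger exponent in `u`. -/
theorem degRevLex_lt_iff {σ : Type*} [LinearOrder σ] [Finite σ] (u v : σ →₀ ℕ) :
    (degRevLex σ).toSyn u < (degRevLex σ).toSyn v ↔
      u.degree < v.degree ∨
        (u.degree = v.degree ∧ ∃ i, (∀ j, j < i → u j = v j) ∧ v i < u i) := by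
  change DegRevLex.keyOf u < DegRevLex.keyOf v ↔ _
  rw [Prod.Lex.lt_iff]
  refine or_congr Iff.rfl (and_congr Iff.rfl ?_)
  change (∃ i, (∀ j, j < i → -(u j : ℤ) = -(v j : ℤ)) ∧ -(u i : ℤ) < -(v i : ℤ)) ↔ _
  simp

/-! ### Toric ideals, initial ideals and initial complexes -/

/-- The toric ideal of the configuration with columns `A s`: the kernel of the homomorphism from
`K[x_s]` to the Laurent polynomial ring `K[M]` that sends `x_s` to `t ^ (A s)`. -/
def toricIdeal (K : Type*) [Field K] {σ M : Type*} [AddCommGroup M] (A : σ → M) :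
    Ideal (MvPolynomial σ K) :=
  RingHom.ker (MvPolynomial.aeval (R := K) fun s =>
    (AddMonoidAlgebra.single (A s) 1 : AddMonoidAlgebra K M))

/-- The initial ideal, generated by the initial monomials of the nonzero elements of `I`. -/
def initialIdeal {K : Type*} [Field K] {σ : Type*} (m : MonomialOrder σ)
    (I : Ideal (MvPolynomial σ K)) : Ideal (MvPolynomial σ K) :=
  Ideal.span {g | ∃ f ∈ I, f ≠ 0 ∧ g = MvPolynomial.monomial (m.degree f) 1}

/-- The initial complex of the configuration with columns `(a s, 1)`: the simplices
`conv {a s | s ∈ B}` for which `∏_{s ∈ B} x_s` is not in the radical of the initial ideal of the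
toric ideal. -/
def initialComplex (K : Type*) [Field K] {σ ι : Type*} (m : MonomialOrder σ) (a : σ → ι → ℤ) :
    Set (Set (ι → ℝ)) :=
  {F | ∃ B : Finset σ,
    ∏ s ∈ B, (MvPolynomial.X s : MvPolynomial σ K) ∉
      (initialIdeal m (toricIdeal K fun s => (a s, (1 : ℤ)))).radical ∧
    F = convexHull ℝ ((fun s => fun i => (a s i : ℝ)) '' (B : Set σ))}

/-! ### Cut polytopes -/

namespace CutPolytope

variable {V : Type*} [Fintype V] [DecidableEq V]

/-- Two subsets `A`, `B` of `V` give the same unordered partition `A | Aᶜ` if they are equal or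
complementary. -/
def partitionSetoid (V : Type*) [Fintype V] [DecidableEq V] : Setoid (Finset V) where
  r A B := B = A ∨ B = Aᶜ
  iseqv :=
    { refl := fun _ => Or.inl rfl
      symm := by
        rintro A B (rfl | rfl)
        · exact Or.inl rfl
        · exact Or.inr (compl_compl A).symm
      trans := by
        rintro A B C (rfl | rfl) (rfl | rfl)
        · exact Or.inl rfl
        · exact Or.inr rfl
        · exact Or.inr rfl
        · exact Or.inl (compl_compl A) }

/-- The unordered partitions `A | B` of `V` into two (possibly empty) parts; `A | B` is represented
by either of `A` and `B = Aᶜ`. -/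
def UnorderedPartition (V : Type*) [Fintype V] [DecidableEq V] : Type _ :=
  Quotient (partitionSetoid V)

instance : Finite (UnorderedPartition V) :=
  inferInstanceAs (Finite (Quotient (partitionSetoid V)))

/-- `min {|A|, |B|}` for the unordered partition `A | B`. -/
def minSize : UnorderedPartition V → ℕ :=
  Quotient.lift (fun A => min A.card Aᶜ.card) (by
    rintro A B (rfl | rfl)
    · rfl
    · simp [min_comm])

/-- The number `|A ∩ e|` of end points of the edge `e` in `A`. -/
def endpointCount (A : Finset V) (e : Sym2 V) : ℕ :=
  (A.filter fun v => v ∈ e).card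

theorem endpointCount_compl (G : SimpleGraph V) (A : Finset V) (e : G.edgeSet) :
    endpointCount Aᶜ e.1 = 1 ↔ endpointCount A e.1 = 1 := by
  have h : endpointCount A e.1 + endpointCount Aᶜ e.1 = 2 := by
    obtain ⟨e, he⟩ := e
    induction e using Sym2.ind with
    | _ x y =>
      have hxy : x ≠ y := G.ne_of_adj he
      rw [endpointCount, endpointCount, ← Finset.card_union_of_disjoint]
      · rw [← Finset.filter_union, Finset.union_compl]
        have : (Finset.univ.filter fun v => v ∈ s(x, y)) = {x, y} := by
          ext v
          simp
        rw [this, Finset.card_pair hxy]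
      · exact Finset.disjoint_filter_filter disjoint_compl_right
  omega

/-- The cut vector `δ_{A|B} ∈ {0,1}^E`, whose coordinate at `e` is `1` if `|A ∩ e| = 1`, and `0`
otherwise. -/
def cutVector (G : SimpleGraph V) : UnorderedPartition V → G.edgeSet → ℤ :=
  Quotient.lift (fun A e => if endpointCount A e.1 = 1 then 1 else 0) (by
    rintro A B (rfl | rfl)
    · rfl
    · funext e
      simp only [endpointCount_compl])

/-- The cut polytope `Cut(G)`, the convex hull of the cut vectors. -/
def cutPolytope (G : SimpleGraph V) : Set (G.edgeSet → ℝ) :=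
  convexHull ℝ (Set.range fun (p : UnorderedPartition V) (e : G.edgeSet) =>
    (cutVector G p e : ℝ))

end CutPolytope

/-! ### Eulerian polynomials -/

/-- The number of descents `|{i | w_i > w_{i+1}}|` of a permutation `w = w_1 ⋯ w_n`. -/
def descentCount {n : ℕ} (w : Equiv.Perm (Fin n)) : ℕ :=
  (Finset.univ.filter fun i : Fin n => ∃ j : Fin n, (j : ℕ) = i + 1 ∧ w j < w i).card

/-- The Eulerian polynomial `A_n(x) = ∑_{w ∈ 𝔖_n} x ^ des(w)`. -/
def eulerianPolynomial (n : ℕ) : ℤ[X] :=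
  ∑ w : Equiv.Perm (Fin n), X ^ descentCount w

end

noncomputable section

/-! ### Volumes of lattice simplices -/

namespace LatticePolytope

open MeasureTheory

theorem mem_convexHull_range_iff {σ E : Type*} [Fintype σ] [AddCommGroup E] [Module ℝ E]
    (v : σ → E) (x : E) :
    x ∈ convexHull ℝ (Set.range v) ↔
      ∃ w : σ → ℝ, (∀ s, 0 ≤ w s) ∧ ∑ s, w s = 1 ∧ ∑ s, w s • v s = x := by
  classical
  have h : Set.range v = Fintype.linearCombination ℝ v '' Set.range fun i j : σ =>
      if i = j then (1 : ℝ) else 0 := by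
    rw [← Set.range_comp]
    congr 1
    funext s
    simp [Fintype.linearCombination_apply, ite_smul]
  rw [h, ← LinearMap.image_convexHull, convexHull_basis_eq_stdSimplex]
  simp [stdSimplex, Fintype.linearCombination_apply, and_assoc]

theorem mem_convexHull_image_iff {σ E : Type*} [Fintype σ] [AddCommGroup E] [Module ℝ E]
    (v : σ → E) (B : Finset σ) (x : E) :
    x ∈ convexHull ℝ (v '' (B : Set σ)) ↔
      ∃ w : σ → ℝ, (∀ s, 0 ≤ w s) ∧ (∀ s, s ∉ B → w s = 0) ∧ ∑ s, w s = 1 ∧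
        ∑ s, w s • v s = x := by
  classical
  have h : v '' (B : Set σ) = Set.range fun s : B => v s := by
    rw [Set.image_eq_range]; rfl
  rw [h, mem_convexHull_range_iff]
  constructor
  · rintro ⟨w, h0, h1, h2⟩
    refine ⟨fun s => if hs : s ∈ B then w ⟨s, hs⟩ else 0, fun s => ?_,
      fun s hs => by simp [hs], ?_, ?_⟩
    · dsimp only
      split_ifs
      exacts [h0 _, le_rfl]
    · rw [← h1, ← Finset.sum_subset (Finset.subset_univ B) (by intro s _ hs; simp [hs]),
        ← Finset.sum_coe_sort]
      simp
    · rw [← h2, ← Finset.sum_subset (Finset.subset_univ B) (by intro s _ hs; simp [hs]),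
        ← Finset.sum_coe_sort]
      simp
  · rintro ⟨w, h0, hB, h1, h2⟩
    refine ⟨fun s => w s, fun s => h0 s, ?_, ?_⟩
    · rw [← h1, ← Finset.sum_subset (Finset.subset_univ B) fun s _ hs => hB s hs]
      exact Finset.sum_coe_sort B w
    · rw [← h2, ← Finset.sum_subset (Finset.subset_univ B)
        fun s _ hs => by rw [hB s hs, zero_smul]]
      exact Finset.sum_coe_sort B fun s => w s • v s

/-- The corner simplex `{x | 0 ≤ x, ∑ x ≤ 1}`. -/
def cornerSimplex (ι : Type*) [Fintype ι] : Set (ι → ℝ) :=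
  {x | (∀ i, 0 ≤ x i) ∧ ∑ i, x i ≤ 1}

theorem volume_coordinate_hyperplane {ι : Type*} [Fintype ι] (i : ι) :
    volume {x : ι → ℝ | x i = 0} = 0 := by
  classical
  have h := Measure.addHaar_submodule (volume : Measure (ι → ℝ))
    (LinearMap.ker (LinearMap.proj (R := ℝ) (φ := fun _ : ι => ℝ) i)) (by
      intro h
      have : (Pi.single i 1 : ι → ℝ) ∈ LinearMap.ker
          (LinearMap.proj (R := ℝ) (φ := fun _ : ι => ℝ) i) := by rw [h]; trivial
      simp at this)
  exact h

theorem measurableSet_cornerSimplex (ι : Type*) [Fintype ι] :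
    MeasurableSet (cornerSimplex ι) := by
  have h1 : IsClosed (cornerSimplex ι) := by
    have : cornerSimplex ι = (⋂ i, {x : ι → ℝ | 0 ≤ x i}) ∩ {x | ∑ i, x i ≤ 1} := by
      ext x; simp [cornerSimplex]
    rw [this]
    exact (isClosed_iInter fun i => isClosed_le (by fun_prop) (by fun_prop)).inter
      (isClosed_le (by fun_prop) (by fun_prop))
  exact h1.measurableSet

theorem volume_real_cornerSimplex (ι : Type*) [Fintype ι] [Nonempty ι] :
    volume.real (cornerSimplex ι) = 1 / ((Fintype.card ι).factorial : ℝ) := by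
  classical
  let g : Bool → ℝ → ℝ := fun b x => if b then x else -x
  let f : (ι → Bool) → (ι → ℝ) → (ι → ℝ) := fun ε x i => g (ε i) (x i)
  have hg (b : Bool) : MeasurePreserving (g b) volume volume := by
    cases b
    · simpa [g] using Measure.measurePreserving_neg (volume : Measure ℝ)
    · simpa [g, Function.id_def] using MeasurePreserving.id (volume : Measure ℝ)
  have hf (ε : ι → Bool) : MeasurePreserving (f ε) volume volume :=
    volume_preserving_pi fun i => hg (ε i)
  have hball := volume_sum_rpow_le ι (p := 1) le_rfl 1
  have hunion : {x : ι → ℝ | (∑ i, |x i| ^ (1 : ℝ)) ^ (1 / (1 : ℝ)) ≤ 1}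
      = ⋃ ε : ι → Bool, f ε ⁻¹' cornerSimplex ι := by
    ext x
    simp only [Real.rpow_one, div_one, Set.mem_ofPred_eq, Set.mem_iUnion, Set.mem_preimage]
    constructor
    · intro hx
      refine ⟨fun i => decide (0 ≤ x i), ?_⟩
      have h : f (fun i => decide (0 ≤ x i)) x = fun i => |x i| := by
        funext i
        by_cases h : 0 ≤ x i
        · simp [f, g, h, abs_of_nonneg h]
        · simp [f, g, h, abs_of_neg (not_le.mp h)]
      rw [h]
      exact ⟨fun i => abs_nonneg _, hx⟩
    · rintro ⟨ε, h0, h1⟩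
      refine le_trans (Finset.sum_le_sum fun i _ => ?_) h1
      have := h0 i
      simp only [f, g] at this ⊢
      split_ifs at this ⊢ with h
      · rw [abs_of_nonneg this]
      · rw [← abs_neg, abs_of_nonneg this]
  rw [hunion, measure_iUnion₀, tsum_fintype] at hball
  · simp only [(hf _).measure_preimage (measurableSet_cornerSimplex ι).nullMeasurableSet] at hball
    rw [Finset.sum_const, Finset.card_univ, Fintype.card_fun, Fintype.card_bool] at hball
    have h2 := congrArg ENNReal.toReal hball
    simp only [nsmul_eq_mul, ENNReal.toReal_mul, ENNReal.ofReal_one, one_pow, one_mul, div_one,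
      ENNReal.toReal_natCast] at h2
    rw [ENNReal.toReal_ofReal (by positivity)] at h2
    have h3 : Real.Gamma (1 + 1) = 1 := by
      have := Real.Gamma_nat_eq_factorial 1
      simpa using this
    rw [h3, Real.Gamma_nat_eq_factorial] at h2
    push_cast at h2
    have h4 : (2 : ℝ) ^ Fintype.card ι ≠ 0 := by positivity
    rw [measureReal_def, ← mul_right_inj' h4, h2]
    ring
  · intro ε δ hne
    obtain ⟨i, hi⟩ := Function.ne_iff.mp hne
    refine measure_mono_null ?_ (volume_coordinate_hyperplane i)
    rintro x ⟨⟨h1, -⟩, ⟨h2, -⟩⟩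
    have h1 := h1 i
    have h2 := h2 i
    simp only [f, g] at h1 h2
    change x i = 0
    cases h : ε i <;> cases h' : δ i <;> simp_all <;> linarith
  · intro ε
    exact ((hf ε).measurable (measurableSet_cornerSimplex ι)).nullMeasurableSet

/-- The simplex spanned by `v` and the points `v + b i` for a basis `b` of the lattice `L` has
normalized volume `1`. -/
theorem normalizedVolumeIn_simplex {ι : Type*} [Fintype ι] [Nonempty ι]
    (b : Module.Basis ι ℝ (ι → ℝ)) (v : ι → ℝ) :
    normalizedVolumeIn (Submodule.span ℤ (Set.range b))
      (convexHull ℝ (insert v (Set.range fun i => v + b i))) = 1 := by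
  classical
  have hcov : ZLattice.covolume (Submodule.span ℤ (Set.range b)) = |(Matrix.of b).det| := by
    rw [ZLattice.covolume_eq_measure_fundamentalDomain _ volume
      (ZSpan.isAddFundamentalDomain b volume), ZSpan.volume_real_fundamentalDomain]
  have hdet : (Matrix.of b).det ≠ 0 := by
    have := ZLattice.covolume_ne_zero (Submodule.span ℤ (Set.range b))
      (volume : Measure (ι → ℝ))
    rw [hcov] at this
    simpa using this
  set T : (ι → ℝ) →ₗ[ℝ] (ι → ℝ) := Matrix.toLin' (Matrix.of b).transpose with hT
  have hTx (x : ι → ℝ) : T x = ∑ i, x i • b i := by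
    rw [hT, Matrix.toLin'_apply, Matrix.mulVec_transpose, Matrix.vecMul_eq_sum]
    rfl
  have hset : convexHull ℝ (insert v (Set.range fun i => v + b i))
      = (fun y => v + y) '' (T '' cornerSimplex ι) := by
    have hr : insert v (Set.range fun i => v + b i)
        = Set.range fun o : Option ι => o.elim v fun i => v + b i := by
      ext x
      simp [Set.mem_range, Option.exists]
      tauto
    rw [hr]
    ext x
    rw [mem_convexHull_range_iff, Set.mem_image]
    constructor
    · rintro ⟨w, h0, h1, rfl⟩
      rw [Fintype.sum_option] at h1
      refine ⟨_, ⟨fun i => w (some i), ⟨fun i => h0 _, by linarith [h0 none]⟩, rfl⟩, ?_⟩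
      simp only [hTx, Fintype.sum_option, Option.elim, smul_add, Finset.sum_add_distrib]
      rw [← Finset.sum_smul, ← add_assoc, ← add_smul, h1, one_smul]
    · rintro ⟨_, ⟨y, ⟨h0, h1⟩, rfl⟩, rfl⟩
      refine ⟨fun o => o.elim (1 - ∑ i, y i) y, ?_, ?_, ?_⟩
      · rintro (_ | i)
        · simpa using h1
        · exact h0 i
      · simp [Fintype.sum_option]
      · simp only [hTx, Fintype.sum_option, Option.elim, smul_add, Finset.sum_add_distrib]
        rw [← Finset.sum_smul, ← add_assoc, ← add_smul, sub_add_cancel, one_smul]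
  rw [normalizedVolumeIn, hcov, hset, Set.image_add_left, measureReal_def,
    measure_preimage_add, Measure.addHaar_image_linearMap, hT, LinearMap.det_toLin',
    Matrix.det_transpose, ENNReal.toReal_mul, ENNReal.toReal_ofReal (abs_nonneg _),
    ← measureReal_def, volume_real_cornerSimplex]
  have : |(Matrix.of b).det| ≠ 0 := by simpa using hdet
  have h2 : ((Fintype.card ι).factorial : ℝ) ≠ 0 := by positivity
  field_simp

end LatticePolytope

/-! ### Weights on chains of finite sets -/

namespace ChainWeight

variable {α : Type*} [Fintype α] [DecidableEq α]

/-- The function `∑_S c_S 1_S` on the ground set. -/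
def cover (c : Finset α → ℝ) (j : α) : ℝ := ∑ S, if j ∈ S then c S else 0

/-- The support of `c` is a chain. -/
def IsChainSupported (c : Finset α → ℝ) : Prop :=
  ∀ S T, c S ≠ 0 → c T ≠ 0 → S ⊆ T ∨ T ⊆ S

theorem cover_add (c d : Finset α → ℝ) (j : α) : cover (c + d) j = cover c j + cover d j := by
  simp only [cover, ← Finset.sum_add_distrib]
  refine Finset.sum_congr rfl fun S _ => ?_
  split_ifs <;> simp

theorem cover_sub (c d : Finset α → ℝ) (j : α) : cover (c - d) j = cover c j - cover d j := by
  simp only [cover, ← Finset.sum_sub_distrib]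
  refine Finset.sum_congr rfl fun S _ => ?_
  split_ifs <;> simp

theorem cover_single (S : Finset α) (r : ℝ) (j : α) :
    cover (Pi.single S r) j = if j ∈ S then r else 0 := by
  rw [cover, Finset.sum_eq_single S]
  · simp
  · intro T _ hT
    simp [hT]
  · simp

theorem cover_nonneg {c : Finset α → ℝ} (hc : ∀ S, 0 ≤ c S) (j : α) : 0 ≤ cover c j :=
  Finset.sum_nonneg fun S _ => by split_ifs; exacts [hc S, le_rfl]

theorem le_cover {c : Finset α → ℝ} (hc : ∀ S, 0 ≤ c S) {S : Finset α} {j : α} (hj : j ∈ S) :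
    c S ≤ cover c j := by
  have := Finset.single_le_sum (f := fun S => if j ∈ S then c S else 0)
    (fun S _ => by split_ifs; exacts [hc S, le_rfl]) (Finset.mem_univ S)
  simp only [hj, if_true] at this
  exact this

theorem cover_le_sum {c : Finset α → ℝ} (hc : ∀ S, 0 ≤ c S) (j : α) : cover c j ≤ ∑ S, c S :=
  Finset.sum_le_sum fun S _ => by split_ifs; exacts [le_rfl, hc S]

theorem eq_zero_of_cover_eq_zero {w : Finset α → ℝ} (hw : IsChainSupported w)
    (h0 : ∑ S, w S = 0) (h1 : ∀ j, cover w j = 0) : w = 0 := by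
  by_contra hne
  obtain ⟨S₀, hS₀⟩ := Function.ne_iff.mp hne
  obtain ⟨S, hS, hmin⟩ := Finset.exists_min_image (Finset.univ.filter fun S => w S ≠ 0)
    Finset.card ⟨S₀, by simpa using hS₀⟩
  have hS : w S ≠ 0 := by simpa using hS
  have key : ∑ V, (if V = S then 0 else w V) = 0 := by
    by_cases hU : (Finset.univ.filter fun V => w V ≠ 0 ∧ V ≠ S).Nonempty
    · obtain ⟨T, hT, hTmin⟩ := Finset.exists_min_image _ Finset.card hU
      obtain ⟨hT, hTS⟩ : w T ≠ 0 ∧ T ≠ S := by simpa using hT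
      have hlt : ¬ T ⊆ S := fun h =>
        hTS (Finset.eq_of_subset_of_card_le h (hmin T (by simpa using hT)))
      obtain ⟨j, hjT, hjS⟩ := Finset.not_subset.mp hlt
      refine Eq.trans ?_ (h1 j)
      refine Finset.sum_congr rfl fun V _ => ?_
      by_cases hVS : V = S
      · simp [hVS, hjS]
      · by_cases hV : w V = 0
        · simp [hV]
        · have hc := hTmin V (by simp [hV, hVS])
          have : T ⊆ V := (hw T V hT hV).elim id fun h =>
            (Finset.eq_of_subset_of_card_le h hc).ge
          simp [hVS, this hjT]
    · refine Finset.sum_eq_zero fun V _ => ?_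
      by_contra h
      exact hU ⟨V, by simpa [and_comm] using h⟩
  have : ∑ V, w V = ∑ V, (if V = S then 0 else w V) + w S := by
    rw [← Finset.sum_erase_add _ _ (Finset.mem_univ S),
      ← Finset.sum_erase_add (a := S) (f := fun V => if V = S then 0 else w V) _
        (Finset.mem_univ S)]
    simp only [if_true, add_zero]
    congr 1
    exact Finset.sum_congr rfl fun V hV => by rw [if_neg (Finset.ne_of_mem_erase hV)]
  rw [h0, key, zero_add] at this
  exact hS this.symm

theorem cover_lt_cover {c : Finset α → ℝ} (hc : ∀ S, 0 ≤ c S) (hch : IsChainSupported c)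
    {S : Finset α} (hS : c S ≠ 0) {j k : α} (hj : j ∈ S) (hk : k ∉ S) : cover c k < cover c j := by
  refine Finset.sum_lt_sum (fun T _ => ?_) ⟨S, Finset.mem_univ _, ?_⟩
  · by_cases hT : c T = 0
    · simp [hT]
    · rcases hch S T hS hT with h | h
      · simp only [h hj, if_true]
        split_ifs
        exacts [le_rfl, hc T]
      · have : k ∉ T := fun h' => hk (h h')
        simp only [this, if_false]
        split_ifs
        exacts [hc T, le_rfl]
  · simpa [hj, hk] using (hc S).lt_of_ne' hS

theorem eq_of_cover_eq {c d : Finset α → ℝ} (hc : ∀ S, 0 ≤ c S) (hd : ∀ S, 0 ≤ d S)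
    (hcc : IsChainSupported c) (hdc : IsChainSupported d) (h0 : ∑ S, c S = ∑ S, d S)
    (h1 : ∀ j, cover c j = cover d j) : c = d := by
  have hcd (S T : Finset α) (hS : c S ≠ 0) (hT : d T ≠ 0) : S ⊆ T ∨ T ⊆ S := by
    by_contra! h
    obtain ⟨j, hj, hj'⟩ := Finset.not_subset.mp h.1
    obtain ⟨k, hk, hk'⟩ := Finset.not_subset.mp h.2
    have h2 := cover_lt_cover hc hcc hS hj hk'
    have h3 := cover_lt_cover hd hdc hT hk hj'
    rw [h1, h1] at h2
    exact lt_asymm h2 h3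
  rw [← sub_eq_zero]
  refine eq_zero_of_cover_eq_zero ?_ (by simp [h0]) fun j => by rw [cover_sub, h1, sub_self]
  intro S T hS hT
  have h (U : Finset α) (hU : (c - d) U ≠ 0) : c U ≠ 0 ∨ d U ≠ 0 := by
    by_contra! h
    simp [h.1, h.2] at hU
  rcases h S hS with hS | hS <;> rcases h T hT with hT | hT
  exacts [hcc S T hS hT, hcd S T hS hT, (hcd T S hT hS).symm, hdc S T hS hT]

theorem exists_cover (p : α → ℝ) (M : ℝ) (hp : ∀ j, 0 ≤ p j) (hpM : ∀ j, p j ≤ M) (hM : 0 ≤ M) :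
    ∃ c : Finset α → ℝ, (∀ S, 0 ≤ c S) ∧ IsChainSupported c ∧ ∑ S, c S = M ∧ cover c = p ∧
      ((∀ j, ∃ z : ℤ, p j = z) → (∃ z : ℤ, M = z) → ∀ S, ∃ z : ℤ, c S = z) := by
  induction h : (Finset.univ.filter fun j => p j ≠ 0).card using Nat.strong_induction_on
    generalizing p M with
  | _ n ih =>
  set T := Finset.univ.filter fun j => p j ≠ 0 with hT
  have memT (j : α) : j ∈ T ↔ p j ≠ 0 := by simp [hT]
  by_cases hTe : T.Nonempty
  · obtain ⟨k, hk, hmin⟩ := T.exists_min_image p hTe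
    have hk0 := (hp k).lt_of_ne' ((memT k).mp hk)
    let q : α → ℝ := fun j => if j ∈ T then p j - p k else 0
    have hqT : (Finset.univ.filter fun j => q j ≠ 0) ⊂ T := by
      refine Finset.ssubset_iff_subset_ne.mpr ⟨fun j hj => ?_, fun he => ?_⟩
      · by_contra h
        simp [q, h] at hj
      · rw [← he] at hk
        simp [q] at hk
    obtain ⟨c, hc0, hcc, hcM, hcp, hci⟩ := ih _ (h ▸ Finset.card_lt_card hqT) q (M - p k)
      (fun j => by
        simp only [q]
        split_ifs with hj
        exacts [sub_nonneg.mpr (hmin j hj), le_rfl])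
      (fun j => by
        simp only [q]
        split_ifs with hj
        exacts [by linarith [hpM j], by linarith [hpM k]])
      (by linarith [hpM k]) rfl
    have hsub (S : Finset α) (hS : c S ≠ 0) : S ⊆ T := by
      intro j hj
      by_contra hjT
      have h1 := le_cover hc0 hj
      rw [hcp] at h1
      simp only [q, hjT, if_false] at h1
      exact hS (le_antisymm h1 (hc0 S))
    refine ⟨c + Pi.single T (p k), ?_, ?_, ?_, ?_, ?_⟩
    · intro S
      by_cases hS : S = T
      · subst hS
        simpa using add_nonneg (hc0 T) hk0.le
      · simpa [hS] using hc0 S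
    · intro S S' hS hS'
      by_cases h1 : S = T
      · by_cases h2 : S' = T
        · exact Or.inl (h1.trans h2.symm).subset
        · right
          rw [h1]
          exact hsub S' (by simpa [h2] using hS')
      · have h3 : c S ≠ 0 := by simpa [h1] using hS
        by_cases h2 : S' = T
        · left
          rw [h2]
          exact hsub S h3
        · exact hcc S S' h3 (by simpa [h2] using hS')
    · simp [Finset.sum_add_distrib, hcM]
    · funext j
      rw [cover_add, hcp, cover_single]
      simp only [q]
      by_cases hj : j ∈ T
      · simp [hj]
      · have : p j = 0 := by simpa using (memT j).not.mp hj
        simp [hj, this]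
    · rintro hpz ⟨N, hN⟩ S
      obtain ⟨zk, hzk⟩ := hpz k
      obtain ⟨z, hz⟩ := hci (fun j => by
        simp only [q]
        obtain ⟨zj, hzj⟩ := hpz j
        split_ifs
        exacts [⟨zj - zk, by push_cast; rw [hzj, hzk]⟩, ⟨0, by simp⟩])
        ⟨N - zk, by push_cast; rw [hN, hzk]⟩ S
      by_cases hS : S = T
      · exact ⟨z + zk, by simp [hS, ← hz, ← hzk]⟩
      · exact ⟨z, by simp [hS, ← hz]⟩
  · have hp0 (j : α) : p j = 0 := by
      by_contra h
      exact hTe ⟨j, (memT j).mpr h⟩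
    refine ⟨Pi.single ∅ M, ?_, ?_, by simp, ?_, ?_⟩
    · intro S
      by_cases hS : S = ∅
      · simpa [hS] using hM
      · simp [hS]
    · intro S T hS hT
      by_cases h : S = ∅
      · simp [h]
      · simp [h] at hS
    · funext j
      rw [cover_single, hp0]
      simp
    · rintro - ⟨N, hN⟩ S
      by_cases hS : S = ∅
      · exact ⟨N, by simp [hS, hN]⟩
      · exact ⟨0, by simp [hS]⟩

theorem exists_int_of_cover {c : Finset α → ℝ} (hc : ∀ S, 0 ≤ c S) (hcc : IsChainSupported c)
    (h0 : ∃ z : ℤ, ∑ S, c S = z) (h1 : ∀ j, ∃ z : ℤ, cover c j = z) (S : Finset α) :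
    ∃ z : ℤ, c S = z := by
  obtain ⟨d, hd, hdc, hd0, hd1, hdi⟩ := exists_cover (cover c) (∑ S, c S) (cover_nonneg hc)
    (cover_le_sum hc) (Finset.sum_nonneg fun S _ => hc S)
  rw [eq_of_cover_eq hc hd hcc hdc hd0.symm fun j => by rw [hd1]]
  exact hdi h1 h0 S

theorem exists_cover_eq_zero [Nonempty α] {c : Finset α → ℝ} (hcc : IsChainSupported c)
    (hu : c Finset.univ = 0) : ∃ j, cover c j = 0 := by
  by_cases h : (Finset.univ.filter fun S => c S ≠ 0).Nonempty
  · obtain ⟨S, hS, hmax⟩ := Finset.exists_max_image _ Finset.card h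
    have hS : c S ≠ 0 := by simpa using hS
    have hSu : S ≠ Finset.univ := fun h => hS (h ▸ hu)
    obtain ⟨j, hj⟩ : ∃ j, j ∉ S := by
      by_contra! h
      exact hSu (Finset.eq_univ_iff_forall.mpr h)
    refine ⟨j, Finset.sum_eq_zero fun T _ => ?_⟩
    by_cases hT : c T = 0
    · simp [hT]
    · have hc := hmax T (by simpa using hT)
      have hTS : T ⊆ S := (hcc T S hT hS).elim id fun h =>
        (Finset.eq_of_subset_of_card_le h hc).ge
      rw [if_neg fun h => hj (hTS h)]
  · obtain ⟨j⟩ := ‹Nonempty α›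
    refine ⟨j, Finset.sum_eq_zero fun T _ => ?_⟩
    have : c T = 0 := by
      by_contra hT
      exact h ⟨T, by simpa using hT⟩
    simp [this]

theorem exists_cover_eq_sum [Nonempty α] {c : Finset α → ℝ} (hcc : IsChainSupported c)
    (he : c ∅ = 0) : ∃ j, cover c j = ∑ S, c S := by
  by_cases h : (Finset.univ.filter fun S => c S ≠ 0).Nonempty
  · obtain ⟨S, hS, hmin⟩ := Finset.exists_min_image _ Finset.card h
    have hS : c S ≠ 0 := by simpa using hS
    obtain ⟨j, hj⟩ : S.Nonempty := Finset.nonempty_iff_ne_empty.mpr fun h => hS (h ▸ he)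
    refine ⟨j, Finset.sum_congr rfl fun T _ => ?_⟩
    by_cases hT : c T = 0
    · simp [hT]
    · have hc := hmin T (by simpa using hT)
      have hTS : S ⊆ T := (hcc S T hS hT).elim id fun h =>
        (Finset.eq_of_subset_of_card_le h hc).ge
      rw [if_pos (hTS hj)]
  · obtain ⟨j⟩ := ‹Nonempty α›
    refine ⟨j, Finset.sum_congr rfl fun T _ => ?_⟩
    have : c T = 0 := by
      by_contra hT
      exact h ⟨T, by simpa using hT⟩
    simp [this]

theorem univ_eq_zero_of_cover_eq_zero {c : Finset α → ℝ} (hc : ∀ S, 0 ≤ c S) {j : α}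
    (h : cover c j = 0) : c Finset.univ = 0 :=
  le_antisymm (h ▸ le_cover hc (Finset.mem_univ j)) (hc _)

theorem empty_eq_zero_of_cover_eq_sum {c : Finset α → ℝ} (hc : ∀ S, 0 ≤ c S) {j : α}
    (h : cover c j = ∑ S, c S) : c ∅ = 0 := by
  have := (Finset.sum_eq_sum_iff_of_le (f := fun S => if j ∈ S then c S else 0) (g := c)
    (fun S _ => by split_ifs; exacts [le_rfl, hc S])).mp h ∅ (Finset.mem_univ _)
  simpa using this.symm

end ChainWeight

namespace ChainWeight

variable {α : Type*} [Fintype α] [DecidableEq α]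

/-- One of the two trivial subsets has weight zero. -/
def IsAntipodeFree (c : Finset α → ℝ) : Prop := c ∅ = 0 ∨ c Finset.univ = 0

theorem abs_two_mul_cover_sub_le {c : Finset α → ℝ} (hc : ∀ S, 0 ≤ c S) (j : α) :
    |2 * cover c j - ∑ S, c S| ≤ ∑ S, c S := by
  rw [abs_le]
  constructor <;> linarith [cover_nonneg hc j, cover_le_sum hc j]

theorem exists_abs_two_mul_cover_sub_eq [Nonempty α] {c : Finset α → ℝ} (hc : ∀ S, 0 ≤ c S)
    (hcc : IsChainSupported c) (ha : IsAntipodeFree c) :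
    ∃ j, |2 * cover c j - ∑ S, c S| = ∑ S, c S := by
  have h0 : 0 ≤ ∑ S, c S := Finset.sum_nonneg fun S _ => hc S
  rcases ha with h | h
  · obtain ⟨j, hj⟩ := exists_cover_eq_sum hcc h
    exact ⟨j, by rw [hj, two_mul, add_sub_cancel_right, abs_of_nonneg h0]⟩
  · obtain ⟨j, hj⟩ := exists_cover_eq_zero hcc h
    exact ⟨j, by rw [hj, mul_zero, zero_sub, abs_neg, abs_of_nonneg h0]⟩

theorem pair_unique [Nonempty α] {c c' d d' : Finset α → ℝ} (hc : ∀ S, 0 ≤ c S)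
    (hc' : ∀ S, 0 ≤ c' S) (hd : ∀ S, 0 ≤ d S) (hd' : ∀ S, 0 ≤ d' S) (hcc : IsChainSupported c)
    (hcc' : IsChainSupported c') (hdc : IsChainSupported d) (hdc' : IsChainSupported d')
    (hca : IsAntipodeFree c') (hda : IsAntipodeFree d')
    (h1 : ∀ j, cover c j + cover c' j = cover d j + cover d' j)
    (h2 : ∀ j, cover c j + (∑ S, c' S - cover c' j) = cover d j + (∑ S, d' S - cover d' j))
    (h3 : ∑ S, c S + ∑ S, c' S = ∑ S, d S + ∑ S, d' S) : c = d ∧ c' = d' := by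
  have hdiff (j : α) : 2 * cover c' j - ∑ S, c' S = 2 * cover d' j - ∑ S, d' S := by
    linarith [h1 j, h2 j]
  have hM : ∑ S, c' S = ∑ S, d' S := by
    refine le_antisymm ?_ ?_
    · obtain ⟨j, hj⟩ := exists_abs_two_mul_cover_sub_eq hc' hcc' hca
      rw [← hj, hdiff]
      exact abs_two_mul_cover_sub_le hd' j
    · obtain ⟨j, hj⟩ := exists_abs_two_mul_cover_sub_eq hd' hdc' hda
      rw [← hj, ← hdiff]
      exact abs_two_mul_cover_sub_le hc' j
  have hp' (j : α) : cover c' j = cover d' j := by linarith [hdiff j]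
  exact ⟨eq_of_cover_eq hc hd hcc hdc (by linarith) fun j => by linarith [h1 j, hp' j],
    eq_of_cover_eq hc' hd' hcc' hdc' hM hp'⟩

theorem pair_exists [Nonempty α] {c c' : Finset α → ℝ} (hc : ∀ S, 0 ≤ c S)
    (hc' : ∀ S, 0 ≤ c' S) :
    ∃ d d' : Finset α → ℝ, (∀ S, 0 ≤ d S) ∧ (∀ S, 0 ≤ d' S) ∧ IsChainSupported d ∧
      IsChainSupported d' ∧ IsAntipodeFree d' ∧
      (∀ j, cover c j + cover c' j = cover d j + cover d' j) ∧
      (∀ j, cover c j + (∑ S, c' S - cover c' j) = cover d j + (∑ S, d' S - cover d' j)) ∧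
      ∑ S, c S + ∑ S, c' S = ∑ S, d S + ∑ S, d' S := by
  obtain ⟨k, -, hk⟩ := Finset.univ.exists_max_image (fun j => |2 * cover c' j - ∑ S, c' S|)
    Finset.univ_nonempty
  set N := |2 * cover c' k - ∑ S, c' S| with hN
  have hNle := abs_two_mul_cover_sub_le hc' k
  have hle (j : α) := abs_le.mp (hk j (Finset.mem_univ j))
  have hM : 0 ≤ ∑ S, c S := Finset.sum_nonneg fun S _ => hc S
  obtain ⟨d', hd', hdc', hd0', hd1', -⟩ := exists_cover
    (fun j => (2 * cover c' j - ∑ S, c' S + N) / 2) N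
    (fun j => by linarith [(hle j).1]) (fun j => by linarith [(hle j).2]) (abs_nonneg _)
  obtain ⟨d, hd, hdc, hd0, hd1, -⟩ := exists_cover
    (fun j => cover c j + (∑ S, c' S - N) / 2) (∑ S, c S + (∑ S, c' S - N))
    (fun j => by linarith [cover_nonneg hc j]) (fun j => by linarith [cover_le_sum hc j])
    (by linarith)
  refine ⟨d, d', hd, hd', hdc, hdc', ?_, fun j => ?_, fun j => ?_, ?_⟩
  · rcases abs_choice (2 * cover c' k - ∑ S, c' S) with h | h
    · left
      refine empty_eq_zero_of_cover_eq_sum hd' (j := k) ?_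
      rw [hd1', hd0']
      dsimp only
      linarith
    · right
      refine univ_eq_zero_of_cover_eq_zero hd' (j := k) ?_
      rw [hd1']
      dsimp only
      linarith
  · rw [hd1, hd1']
    ring
  · rw [hd1, hd1', hd0']
    ring
  · rw [hd0, hd0']
    ring

theorem pair_int [Nonempty α] {c c' : Finset α → ℝ} (hc : ∀ S, 0 ≤ c S)
    (hc' : ∀ S, 0 ≤ c' S) (hcc : IsChainSupported c)
    (hcc' : IsChainSupported c') (hca : IsAntipodeFree c')
    (h1 : ∀ j, ∃ z : ℤ, cover c j + cover c' j = z)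
    (h2 : ∀ j k, ∃ z : ℤ, (cover c j + cover c' j) + (cover c j + (∑ S, c' S - cover c' j)) -
      ((cover c k + cover c' k) + (cover c k + (∑ S, c' S - cover c' k))) = 2 * z)
    (h3 : ∀ j, ∃ z : ℤ, cover c j + (∑ S, c' S - cover c' j) = z)
    (h4 : ∃ z : ℤ, ∑ S, c S + ∑ S, c' S = z) :
    (∀ S, ∃ z : ℤ, c S = z) ∧ ∀ S, ∃ z : ℤ, c' S = z := by
  obtain ⟨k, hk⟩ := exists_abs_two_mul_cover_sub_eq hc' hcc' hca
  obtain ⟨x, hx⟩ := h1 k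
  obtain ⟨y, hy⟩ := h3 k
  have hM' : ∑ S, c' S = ((x - y : ℤ) : ℝ) ∨ ∑ S, c' S = ((y - x : ℤ) : ℝ) := by
    rcases abs_choice (2 * cover c' k - ∑ S, c' S) with h | h
    · left; push_cast; linarith
    · right; push_cast; linarith
  have hp' (j : α) : ∃ z : ℤ, cover c' j = z := by
    obtain ⟨z, hz⟩ := h2 j k
    obtain ⟨x', hx'⟩ := h1 j
    obtain ⟨y', hy'⟩ := h3 j
    rcases hM' with h | h
    · exact ⟨z + x - y', by push_cast at h ⊢; linarith⟩
    · exact ⟨z + y - y', by push_cast at h ⊢; linarith⟩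
  have hMi : ∃ z : ℤ, ∑ S, c' S = z := hM'.elim (fun h => ⟨_, h⟩) fun h => ⟨_, h⟩
  refine ⟨exists_int_of_cover hc hcc ?_ fun j => ?_, exists_int_of_cover hc' hcc' hMi hp'⟩
  · obtain ⟨z, hz⟩ := hMi
    obtain ⟨z', hz'⟩ := h4
    exact ⟨z' - z, by push_cast; linarith⟩
  · obtain ⟨z, hz⟩ := hp' j
    obtain ⟨z', hz'⟩ := h1 j
    exact ⟨z' - z, by push_cast; linarith⟩

end ChainWeight

/-! ### Unimodular systems of faces -/

namespace LatticePolytope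

open scoped Classical

variable {σ ι : Type*} [Fintype σ]

/-- The real vector `a s`. -/
def realPoint (a : σ → ι → ℤ) (s : σ) : ι → ℝ := fun i => (a s i : ℝ)

/-- The column `(a s, 1)`. -/
def column (a : σ → ι → ℤ) (s : σ) : (ι → ℝ) × ℝ := (realPoint a s, 1)

/-- The linear combination of the columns with coefficients `c`. -/
def columnSum (a : σ → ι → ℤ) (c : σ → ℝ) : (ι → ℝ) × ℝ := ∑ s, c s • column a s

/-- The support of a function on a finite type. -/
def supp {R : Type*} [Zero R] (c : σ → R) : Finset σ := Finset.univ.filter fun s => c s ≠ 0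

/-- A down-closed family of faces such that every point of the cone over the columns has a unique
nonnegative representation supported on a face, which is integral for lattice points, and such that
all maximal faces are full-dimensional. -/
structure IsUnimodularSystem [Fintype ι] (a : σ → ι → ℤ) (Face : Finset σ → Prop) : Prop where
  zero_or_one : ∀ s i, a s i = 0 ∨ a s i = 1
  down_closed : ∀ {B C}, Face B → C ⊆ B → Face C
  unique : ∀ {c d : σ → ℝ}, (∀ s, 0 ≤ c s) → (∀ s, 0 ≤ d s) → Face (supp c) → Face (supp d) →
    columnSum a c = columnSum a d → c = d
  exists_rep : ∀ c : σ → ℝ, (∀ s, 0 ≤ c s) →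
    ∃ d : σ → ℝ, (∀ s, 0 ≤ d s) ∧ Face (supp d) ∧ columnSum a c = columnSum a d
  integral : ∀ c : σ → ℝ, (∀ s, 0 ≤ c s) → Face (supp c) →
    columnSum a c ∈ Submodule.span ℤ (Set.range (column a)) → ∀ s, ∃ z : ℤ, c s = z
  pure : ∀ B, Face B → ∃ C, B ⊆ C ∧ Face C ∧ C.card = Fintype.card ι + 1

theorem mem_supp {R : Type*} [Zero R] {c : σ → R} {s : σ} : s ∈ supp c ↔ c s ≠ 0 := by simp [supp]

theorem columnSum_fst (a : σ → ι → ℤ) (c : σ → ℝ) :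
    (columnSum a c).1 = ∑ s, c s • realPoint a s := by
  simp [columnSum, column, Prod.fst_sum]

theorem columnSum_snd (a : σ → ι → ℤ) (c : σ → ℝ) : (columnSum a c).2 = ∑ s, c s := by
  simp [columnSum, column, Prod.snd_sum]

theorem columnSum_add (a : σ → ι → ℤ) (c d : σ → ℝ) :
    columnSum a (c + d) = columnSum a c + columnSum a d := by
  simp [columnSum, add_smul, Finset.sum_add_distrib]

theorem columnSum_sub (a : σ → ι → ℤ) (c d : σ → ℝ) :
    columnSum a (c - d) = columnSum a c - columnSum a d := by
  simp [columnSum, sub_smul, Finset.sum_sub_distrib]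

theorem columnSum_eq_mk (a : σ → ι → ℤ) {c : σ → ℝ} {x : ι → ℝ} {r : ℝ}
    (h : ∑ s, c s • realPoint a s = x) (h' : ∑ s, c s = r) : columnSum a c = (x, r) :=
  Prod.ext ((columnSum_fst a c).trans h) ((columnSum_snd a c).trans h')

theorem columnSum_mem_span (a : σ → ι → ℤ) {c : σ → ℝ} (hc : ∀ s, ∃ z : ℤ, c s = z) :
    columnSum a c ∈ Submodule.span ℤ (Set.range (column a)) := by
  refine Submodule.sum_mem _ fun s _ => ?_
  obtain ⟨z, hz⟩ := hc s
  rw [hz, Int.cast_smul_eq_zsmul]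
  exact Submodule.smul_mem _ _ (Submodule.subset_span ⟨s, rfl⟩)

end LatticePolytope

namespace LatticePolytope

open scoped Classical

theorem single_one_nonneg {σ : Type*} (s t : σ) : 0 ≤ (Pi.single s (1 : ℝ) : σ → ℝ) t := by
  by_cases h : t = s
  · subst h; simp
  · simp [h]

variable {σ ι : Type*} [Fintype σ]

theorem convexHull_image_realPoint_iff (a : σ → ι → ℤ) (B : Finset σ) (x : ι → ℝ) :
    x ∈ convexHull ℝ (realPoint a '' (B : Set σ)) ↔
      ∃ w : σ → ℝ, (∀ s, 0 ≤ w s) ∧ supp w ⊆ B ∧ columnSum a w = (x, 1) := by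
  rw [mem_convexHull_image_iff]
  refine exists_congr fun w => and_congr_right fun _ => and_congr ?_ ?_
  · refine forall_congr' fun s => ?_
    rw [mem_supp, not_imp_comm]
  · rw [Prod.ext_iff, columnSum_fst, columnSum_snd, and_comm]

theorem convexHull_range_realPoint_iff (a : σ → ι → ℤ) (x : ι → ℝ) :
    x ∈ convexHull ℝ (Set.range (realPoint a)) ↔
      ∃ w : σ → ℝ, (∀ s, 0 ≤ w s) ∧ columnSum a w = (x, 1) := by
  have := convexHull_image_realPoint_iff a Finset.univ x
  simpa using this

/-- The integral points of a `0/1`-polytope are its vertices. -/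
theorem latticePoints_convexHull [Fintype ι] {a : σ → ι → ℤ} (ha : ∀ s i, a s i = 0 ∨ a s i = 1) :
    latticePoints (convexHull ℝ (Set.range (realPoint a))) = Set.range (realPoint a) := by
  refine Set.Subset.antisymm ?_ ?_
  · rintro x ⟨hx, hz⟩
    obtain ⟨w, hw, hwx⟩ := (convexHull_range_realPoint_iff a x).mp hx
    have h1 : ∑ s, w s = 1 := by rw [← columnSum_snd a w, hwx]
    have h2 (i : ι) : ∑ s, w s * realPoint a s i = x i := by
      have := congrFun (congrArg Prod.fst hwx) i
      rw [columnSum_fst] at this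
      simpa using this
    have h01 (i : ι) : x i = 0 ∨ x i = 1 := by
      obtain ⟨z, hz⟩ := hz i
      have h3 : 0 ≤ x i := by
        rw [← h2]
        refine Finset.sum_nonneg fun s _ => mul_nonneg (hw s) ?_
        rcases ha s i with h | h <;> simp [realPoint, h]
      have h4 : x i ≤ 1 := by
        rw [← h2, ← h1]
        refine Finset.sum_le_sum fun s _ => mul_le_of_le_one_right (hw s) ?_
        rcases ha s i with h | h <;> simp [realPoint, h]
      rw [hz] at h3 h4 ⊢
      have h3 : 0 ≤ z := by exact_mod_cast h3
      have h4 : z ≤ 1 := by exact_mod_cast h4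
      obtain rfl | rfl : z = 0 ∨ z = 1 := by omega
      · simp
      · simp
    obtain ⟨s, -, hs⟩ : ∃ s ∈ Finset.univ, w s ≠ 0 :=
      Finset.exists_ne_zero_of_sum_ne_zero (by rw [h1]; exact one_ne_zero)
    refine ⟨s, funext fun i => ?_⟩
    rcases h01 i with hi | hi
    · have h5 := h2 i
      rw [hi, Finset.sum_eq_zero_iff_of_nonneg] at h5
      · have := h5 s (Finset.mem_univ s)
        rw [hi]
        exact (mul_eq_zero.mp this).resolve_left hs
      · intro s _
        refine mul_nonneg (hw s) ?_
        rcases ha s i with h | h <;> simp [realPoint, h]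
    · have h5 : ∑ s, w s * (1 - realPoint a s i) = 0 := by
        simp only [mul_sub, mul_one, Finset.sum_sub_distrib, h2, h1, hi, sub_self]
      rw [Finset.sum_eq_zero_iff_of_nonneg] at h5
      · have := h5 s (Finset.mem_univ s)
        have := (mul_eq_zero.mp this).resolve_left hs
        rw [hi]
        linarith
      · intro s _
        refine mul_nonneg (hw s) ?_
        rcases ha s i with h | h <;> simp [realPoint, h]
  · rintro _ ⟨s, rfl⟩
    exact ⟨subset_convexHull _ _ ⟨s, rfl⟩, fun i => ⟨a s i, rfl⟩⟩

theorem columns_convexHull [Fintype ι] {a : σ → ι → ℤ} (ha : ∀ s i, a s i = 0 ∨ a s i = 1) :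
    columns (convexHull ℝ (Set.range (realPoint a))) = Set.range (column a) := by
  rw [columns, latticePoints_convexHull ha, ← Set.range_comp]
  rfl

theorem columnLattice_convexHull [Fintype ι] {a : σ → ι → ℤ}
    (ha : ∀ s i, a s i = 0 ∨ a s i = 1) :
    columnLattice (convexHull ℝ (Set.range (realPoint a))) =
      Submodule.span ℤ (Set.range (column a)) := by
  rw [columnLattice, columns_convexHull ha]

theorem mem_heightZeroLattice_convexHull [Fintype ι] {a : σ → ι → ℤ}
    (ha : ∀ s i, a s i = 0 ∨ a s i = 1) (v : ι → ℝ) :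
    v ∈ heightZeroLattice (convexHull ℝ (Set.range (realPoint a))) ↔
      (v, (0 : ℝ)) ∈ Submodule.span ℤ (Set.range (column a)) := by
  rw [heightZeroLattice, columnLattice_convexHull ha]
  rfl

theorem columnSum_extend (a : σ → ι → ℤ) {C : Finset σ} (g : C → ℝ) :
    columnSum a (fun s => if hs : s ∈ C then g ⟨s, hs⟩ else 0) = ∑ s : C, g s • column a s := by
  rw [columnSum, ← Finset.sum_subset (Finset.subset_univ C) (by intro s _ hs; simp [hs]),
    ← Finset.sum_coe_sort]
  simp

theorem supp_extend_subset {C : Finset σ} (g : C → ℝ) :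
    supp (fun s => if hs : s ∈ C then g ⟨s, hs⟩ else 0) ⊆ C := by
  intro s hs
  by_contra h
  simp [mem_supp, h] at hs

theorem supp_single_one (s : σ) : supp (Pi.single s (1 : ℝ)) = {s} := by
  ext t
  by_cases h : t = s <;> simp [mem_supp, h]

theorem columnSum_single_one (a : σ → ι → ℤ) (s : σ) :
    columnSum a (Pi.single s (1 : ℝ)) = column a s := by
  rw [columnSum, Finset.sum_eq_single s]
  · simp
  · intro t _ h
    simp [h]
  · simp

namespace IsUnimodularSystem

variable [Fintype ι] {a : σ → ι → ℤ} {Face : Finset σ → Prop}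

theorem eq_zero_of_columnSum_eq_zero (h : IsUnimodularSystem a Face) {w : σ → ℝ}
    (hw : Face (supp w)) (h0 : columnSum a w = 0) : w = 0 := by
  have h1 : (fun s => max (w s) 0) = fun s => max (-w s) 0 := by
    refine h.unique (fun s => le_max_right _ _) (fun s => le_max_right _ _)
      (h.down_closed hw fun s hs => ?_) (h.down_closed hw fun s hs => ?_) ?_
    · rw [mem_supp] at hs ⊢
      exact fun h => hs (by simp [h])
    · rw [mem_supp] at hs ⊢
      exact fun h => hs (by simp [h])
    · rw [← sub_eq_zero, ← columnSum_sub, ← h0]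
      congr 1
      funext s
      rw [Pi.sub_apply]
      rcases le_total (w s) 0 with hs | hs
      · rw [max_eq_right hs, max_eq_left (by linarith)]; ring
      · rw [max_eq_left hs, max_eq_right (by linarith)]; ring
  funext s
  have := congrFun h1 s
  rcases le_total (w s) 0 with hs | hs
  · rw [max_eq_right hs, max_eq_left (by linarith)] at this
    simpa using this.symm
  · rwa [max_eq_left hs, max_eq_right (by linarith)] at this

theorem linearIndependent_column (h : IsUnimodularSystem a Face) {C : Finset σ} (hC : Face C) :
    LinearIndependent ℝ fun s : C => column a s := by
  rw [Fintype.linearIndependent_iff]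
  intro g hg s
  rw [← columnSum_extend] at hg
  have h0 := h.eq_zero_of_columnSum_eq_zero
    (h.down_closed hC (supp_extend_subset g)) hg
  have := congrFun h0 s
  simpa using this

theorem int_of_columnSum_mem (h : IsUnimodularSystem a Face) {C : Finset σ} (hC : Face C)
    {w : σ → ℝ} (hw : supp w ⊆ C)
    (hx : columnSum a w ∈ Submodule.span ℤ (Set.range (column a))) (s : σ) :
    ∃ z : ℤ, w s = z := by
  obtain ⟨N, hN⟩ : ∃ N : ℕ, ∀ s, -w s ≤ N := by
    obtain ⟨s₀⟩ : Nonempty σ := ⟨s⟩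
    obtain ⟨s₁, -, hs₁⟩ := Finset.univ.exists_max_image (fun s => -w s) ⟨s₀, Finset.mem_univ _⟩
    obtain ⟨N, hN⟩ := exists_nat_ge (-w s₁)
    exact ⟨N, fun s => (hs₁ s (Finset.mem_univ s)).trans hN⟩
  let u : σ → ℝ := fun s => if s ∈ C then (N : ℝ) else 0
  have hu (s : σ) : ∃ z : ℤ, u s = z := by
    by_cases hs : s ∈ C
    · exact ⟨N, by simp [u, hs]⟩
    · exact ⟨0, by simp [u, hs]⟩
  have hw0 (s : σ) (hs : s ∉ C) : w s = 0 := by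
    by_contra h
    exact hs (hw (mem_supp.mpr h))
  obtain ⟨z, hz⟩ := h.integral (w + u) (fun s => by
      by_cases hs : s ∈ C
      · have := hN s
        simp only [Pi.add_apply, u, hs, if_true]
        linarith
      · simp [u, hs, hw0 s hs])
    (h.down_closed hC fun s hs => by
      by_contra hs'
      simp [mem_supp, u, hs', hw0 s hs'] at hs)
    (by
      rw [columnSum_add]
      exact add_mem hx (columnSum_mem_span a hu)) s
  obtain ⟨z', hz'⟩ := hu s
  refine ⟨z - z', ?_⟩
  rw [Pi.add_apply] at hz
  push_cast
  linarith

/-- The simplex of a full-dimensional face has normalized volume `1`. -/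
theorem normalizedVolumeIn_face [Nonempty ι] (h : IsUnimodularSystem a Face) {C : Finset σ}
    (hC : Face C) (hcard : C.card = Fintype.card ι + 1) :
    normalizedVolumeIn (heightZeroLattice (convexHull ℝ (Set.range (realPoint a))))
      (convexHull ℝ (realPoint a '' (C : Set σ))) = 1 := by
  obtain ⟨v, D, hvD, rfl, hD⟩ := Finset.card_eq_succ.mp hcard
  obtain ⟨e⟩ : Nonempty (ι ≃ D) := ⟨Fintype.equivOfCardEq (by simp [hD])⟩
  have hsum (g : ι → ℝ) (r : ℝ) :
      columnSum a (fun s => if hs : s ∈ D then g (e.symm ⟨s, hs⟩) else if s = v then r else 0) =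
        (∑ i, g i • realPoint a (e i) + r • realPoint a v, ∑ i, g i + r) := by
    rw [columnSum, ← Finset.sum_subset (Finset.subset_univ (insert v D))
      (by intro s _ hs; simp only [Finset.mem_insert, not_or] at hs; simp [hs]),
      Finset.sum_insert hvD, ← Finset.sum_coe_sort D, ← Equiv.sum_comp e]
    simp only [hvD, Subtype.coe_eta, Equiv.symm_apply_apply, dite_true, Finset.coe_mem, if_true,
      dite_false]
    refine Prod.ext ?_ ?_
    · simp [column, Prod.fst_sum, add_comm]
    · simp [column, Prod.snd_sum, add_comm]
  have hcomb (g : ι → ℝ) : ∑ i, g i • (realPoint a (e i) - realPoint a v) =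
      ∑ i, g i • realPoint a (e i) + (-∑ i, g i) • realPoint a v := by
    simp only [smul_sub, Finset.sum_sub_distrib]
    rw [neg_smul, Finset.sum_smul, sub_eq_add_neg]
  have hli : LinearIndependent ℝ fun i => realPoint a (e i) - realPoint a v := by
    rw [Fintype.linearIndependent_iff]
    intro g hg i
    have h0 := h.eq_zero_of_columnSum_eq_zero (w := fun s => if hs : s ∈ D then
        g (e.symm ⟨s, hs⟩) else if s = v then -∑ i, g i else 0)
      (h.down_closed hC fun s hs => by
        by_contra hs'
        simp only [Finset.mem_insert, not_or] at hs'
        simp [mem_supp, hs'] at hs)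
      (by
        rw [hsum g]
        exact Prod.ext ((hcomb g).symm.trans hg) (by simp))
    have := congrFun h0 (e i)
    simpa using this
  set b := basisOfLinearIndependentOfCardEqFinrank hli (by simp) with hb
  have hbi (i : ι) : b i = realPoint a (e i) - realPoint a v := by simp [hb]
  have hL : heightZeroLattice (convexHull ℝ (Set.range (realPoint a))) =
      Submodule.span ℤ (Set.range b) := by
    refine le_antisymm ?_ ?_
    · intro x hx
      rw [mem_heightZeroLattice_convexHull h.zero_or_one] at hx
      obtain ⟨g, hg⟩ := (Submodule.mem_span_range_iff_exists_fun ℝ).mp (b.mem_span x)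
      have hw : columnSum a (fun s => if hs : s ∈ D then g (e.symm ⟨s, hs⟩) else
          if s = v then -∑ i, g i else 0) = (x, 0) := by
        rw [hsum g]
        refine Prod.ext ((hcomb g).symm.trans ?_) (by simp)
        rw [← hg]
        simp only [hbi]
      have hint := h.int_of_columnSum_mem hC (w := fun s => if hs : s ∈ D then
          g (e.symm ⟨s, hs⟩) else if s = v then -∑ i, g i else 0)
        (fun s hs => by
          by_contra hs'
          simp only [Finset.mem_insert, not_or] at hs'
          simp [mem_supp, hs'] at hs) (by rwa [hw])
      rw [← hg]
      refine Submodule.sum_mem _ fun i _ => ?_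
      obtain ⟨z, hz⟩ := hint (e i)
      simp only [Finset.coe_mem, dite_true, Subtype.coe_eta, Equiv.symm_apply_apply] at hz
      rw [hz, Int.cast_smul_eq_zsmul]
      exact Submodule.smul_mem _ _ (Submodule.subset_span ⟨i, rfl⟩)
    · rw [Submodule.span_le]
      rintro _ ⟨i, rfl⟩
      rw [SetLike.mem_coe, mem_heightZeroLattice_convexHull h.zero_or_one, hbi]
      have : (realPoint a (e i) - realPoint a v, (0 : ℝ)) = column a (e i) - column a v := by
        simp [column]
      rw [this]
      exact sub_mem (Submodule.subset_span ⟨_, rfl⟩) (Submodule.subset_span ⟨_, rfl⟩)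
  have hset : realPoint a '' ((insert v D : Finset σ) : Set σ) =
      insert (realPoint a v) (Set.range fun i => realPoint a v + b i) := by
    rw [Finset.coe_insert, Set.image_insert_eq]
    congr 1
    ext x
    simp only [hbi, add_sub_cancel, Set.mem_image, Set.mem_range, Finset.mem_coe]
    constructor
    · rintro ⟨s, hs, rfl⟩
      exact ⟨e.symm ⟨s, hs⟩, by simp⟩
    · rintro ⟨i, rfl⟩
      exact ⟨e i, (e i).2, rfl⟩
  rw [hL, hset]
  exact normalizedVolumeIn_simplex b _

end IsUnimodularSystem
end LatticePolytope

namespace LatticePolytope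

open scoped Classical

variable {σ ι : Type*} [Fintype σ]

/-- The simplices spanned by the faces, the empty one included. -/
def faceComplex (a : σ → ι → ℤ) (Face : Finset σ → Prop) : Set (Set (ι → ℝ)) :=
  {F | ∃ B, Face B ∧ F = convexHull ℝ (realPoint a '' (B : Set σ))}

namespace IsUnimodularSystem

variable [Fintype ι] {a : σ → ι → ℤ} {Face : Finset σ → Prop}

theorem face_empty (h : IsUnimodularSystem a Face) : Face ∅ := by
  obtain ⟨d, -, hd, -⟩ := h.exists_rep 0 fun _ => le_rfl
  exact h.down_closed hd (Finset.empty_subset _)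

theorem face_singleton (h : IsUnimodularSystem a Face) {B : Finset σ} (hB : Face B) {s : σ}
    (hs : s ∈ B) : Face {s} :=
  h.down_closed hB (Finset.singleton_subset_iff.mpr hs)

theorem card_le (h : IsUnimodularSystem a Face) {B : Finset σ} (hB : Face B) :
    B.card ≤ Fintype.card ι + 1 := by
  obtain ⟨C, hBC, -, hC⟩ := h.pure B hB
  exact hC ▸ Finset.card_le_card hBC

theorem mem_of_realPoint_mem (h : IsUnimodularSystem a Face) {C : Finset σ} {s : σ}
    (hs : Face {s}) (hC : Face C)
    (hsC : realPoint a s ∈ convexHull ℝ (realPoint a '' (C : Set σ))) :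
    s ∈ C := by
  obtain ⟨w, hw, hwC, hsum⟩ := (convexHull_image_realPoint_iff a C _).mp hsC
  have := h.unique hw (single_one_nonneg s) (h.down_closed hC hwC) (by rwa [supp_single_one])
    (by rw [columnSum_single_one, hsum, column])
  refine hwC ?_
  rw [this, supp_single_one]
  exact Finset.mem_singleton_self s

theorem subset_of_convexHull_subset (h : IsUnimodularSystem a Face) {B C : Finset σ}
    (hB : Face B) (hC : Face C)
    (hBC : convexHull ℝ (realPoint a '' (B : Set σ)) ⊆ convexHull ℝ (realPoint a '' (C : Set σ))) :
    B ⊆ C := fun _ hs =>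
  h.mem_of_realPoint_mem (h.face_singleton hB hs) hC
    (hBC (subset_convexHull ℝ _ (Set.mem_image_of_mem _ hs)))

theorem convexHull_inter_subset (h : IsUnimodularSystem a Face) {B C : Finset σ}
    (hB : Face B) (hC : Face C) :
    convexHull ℝ (realPoint a '' (B : Set σ)) ∩ convexHull ℝ (realPoint a '' (C : Set σ)) ⊆
      convexHull ℝ (realPoint a '' ((B ∩ C : Finset σ) : Set σ)) := by
  rintro x ⟨hxB, hxC⟩
  obtain ⟨w, hw, hwB, hwx⟩ := (convexHull_image_realPoint_iff a B _).mp hxB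
  obtain ⟨u, hu, huC, hux⟩ := (convexHull_image_realPoint_iff a C _).mp hxC
  have := h.unique hw hu (h.down_closed hB hwB) (h.down_closed hC huC) (hwx.trans hux.symm)
  subst this
  exact (convexHull_image_realPoint_iff a _ _).mpr
    ⟨w, hw, Finset.subset_inter hwB huC, hwx⟩

theorem affineIndependent (h : IsUnimodularSystem a Face) {B : Finset σ} (hB : Face B) :
    AffineIndependent ℝ fun s : B => realPoint a s := by
  rw [affineIndependent_iff_of_fintype]
  intro g hg hg'
  rw [Finset.weightedVSub_eq_linear_combination _ hg] at hg'
  refine Fintype.linearIndependent_iff.mp (h.linearIndependent_column hB) g ?_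
  refine Prod.ext ?_ ?_
  · simpa [column, Prod.fst_sum] using hg'
  · simpa [column, Prod.snd_sum] using hg

theorem dim_convexHull (h : IsUnimodularSystem a Face) {B : Finset σ} (hB : Face B) {k : ℕ}
    (hk : B.card = k + 1) : dim (convexHull ℝ (realPoint a '' (B : Set σ))) = k := by
  rw [dim, ← direction_affineSpan, affineSpan_convexHull, direction_affineSpan,
    Set.image_eq_range]
  exact (h.affineIndependent hB).finrank_vectorSpan (by simpa using hk)

/-- The geometric simplicial complex formed by the faces. -/
def simplicialComplex (h : IsUnimodularSystem a Face) :
    Geometry.SimplicialComplex ℝ (ι → ℝ) where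
  faces := {s | ∃ B, Face B ∧ B.Nonempty ∧ s = B.image (realPoint a)}
  isRelLowerSet_faces := by
    rintro _ ⟨B, hB, hne, rfl⟩
    refine ⟨hne.image _, fun t ht htne => ?_⟩
    obtain ⟨C, hC, rfl⟩ := Finset.subset_image_iff.mp ht
    exact ⟨C, h.down_closed hB (by exact_mod_cast hC), Finset.image_nonempty.mp htne, rfl⟩
  indep := by
    rintro _ ⟨B, hB, -, rfl⟩
    have h1 := (h.affineIndependent hB).range
    have h2 : Set.range (fun s : B => realPoint a s) = (B.image (realPoint a) : Set (ι → ℝ)) := by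
      rw [Finset.coe_image, Set.image_eq_range]
      rfl
    rw [h2] at h1
    exact h1
  inter_subset_convexHull := by
    rintro _ _ ⟨B, hB, -, rfl⟩ ⟨C, hC, -, rfl⟩
    rw [Finset.coe_image, Finset.coe_image]
    refine (h.convexHull_inter_subset hB hC).trans (convexHull_mono ?_)
    rw [Finset.coe_inter]
    exact Set.image_inter_subset _ _ _

theorem iUnion_convexHull_eq (h : IsUnimodularSystem a Face) :
    ⋃ C ∈ Finset.univ.filter fun C => Face C ∧ C.card = Fintype.card ι + 1,
      convexHull ℝ (realPoint a '' (C : Set σ)) = convexHull ℝ (Set.range (realPoint a)) := by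
  refine Set.Subset.antisymm ?_ ?_
  · refine Set.iUnion₂_subset fun C _ => convexHull_mono (Set.image_subset_range _ _)
  · intro x hx
    obtain ⟨w, hw, hwx⟩ := (convexHull_range_realPoint_iff a x).mp hx
    obtain ⟨d, hd, hdF, hdx⟩ := h.exists_rep w hw
    obtain ⟨C, hdC, hC, hcard⟩ := h.pure _ hdF
    simp only [Set.mem_iUnion]
    exact ⟨C, by simp [hC, hcard], (convexHull_image_realPoint_iff a C x).mpr
      ⟨d, hd, hdC, hdx ▸ hwx⟩⟩

theorem isUnimodularTriangulation [Nonempty ι] (h : IsUnimodularSystem a Face) :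
    IsUnimodularTriangulation (convexHull ℝ (Set.range (realPoint a))) (faceComplex a Face) := by
  refine ⟨h.simplicialComplex, ?_, ?_, ?_, ?_⟩
  · ext F
    simp only [faceComplex, Set.mem_ofPred_eq, Set.mem_insert_iff, Set.mem_image]
    constructor
    · rintro ⟨B, hB, rfl⟩
      rcases B.eq_empty_or_nonempty with rfl | hne
      · left; simp
      · exact Or.inr ⟨_, ⟨B, hB, hne, rfl⟩, by rw [Finset.coe_image]⟩
    · rintro (rfl | ⟨_, ⟨B, hB, -, rfl⟩, rfl⟩)
      · exact ⟨∅, h.face_empty, by simp⟩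
      · exact ⟨B, hB, by rw [Finset.coe_image]⟩
  · rintro x ⟨B, -, -, hx⟩
    rw [latticePoints_convexHull h.zero_or_one]
    have : x ∈ B.image (realPoint a) := hx ▸ Finset.mem_singleton_self x
    obtain ⟨s, -, rfl⟩ := Finset.mem_image.mp this
    exact ⟨s, rfl⟩
  · rw [← h.iUnion_convexHull_eq]
    refine Set.Subset.antisymm ?_ ?_
    · rw [h.iUnion_convexHull_eq]
      refine Set.iUnion₂_subset ?_
      rintro _ ⟨B, -, -, rfl⟩
      rw [Finset.coe_image]
      exact convexHull_mono (Set.image_subset_range _ _)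
    · refine Set.iUnion₂_subset fun C hC => ?_
      obtain ⟨hC, hcard⟩ : Face C ∧ C.card = Fintype.card ι + 1 := by simpa using hC
      have := h.simplicialComplex.convexHull_subset_space (s := C.image (realPoint a))
        ⟨C, hC, Finset.card_pos.mp (by omega), rfl⟩
      rwa [Finset.coe_image] at this
  · rintro _ ⟨⟨B, hB, -, rfl⟩, hmax⟩
    obtain ⟨C, hBC, hC, hcard⟩ := h.pure B hB
    rw [hmax (t := C.image (realPoint a)) ⟨C, hC, Finset.card_pos.mp (by omega), rfl⟩
      (Finset.image_subset_image hBC), Finset.coe_image]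
    exact h.normalizedVolumeIn_face hC hcard

theorem dim_polytope (h : IsUnimodularSystem a Face) :
    dim (convexHull ℝ (Set.range (realPoint a))) = Fintype.card ι := by
  refine le_antisymm ?_ ?_
  · exact (Submodule.finrank_le _).trans (by simp)
  · obtain ⟨C, -, hC, hcard⟩ := h.pure ∅ h.face_empty
    rw [← h.dim_convexHull hC hcard]
    exact Submodule.finrank_mono (vectorSpan_mono ℝ
      (convexHull_mono (Set.image_subset_range _ _)))

theorem faceNumber_eq (h : IsUnimodularSystem a Face) (i : ℕ) :
    faceNumber (faceComplex a Face) i =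
      (Finset.univ.filter fun B : Finset σ => Face B ∧ B.card = i).card := by
  cases i with
  | zero =>
    rw [faceNumber, eq_comm, Finset.card_eq_one]
    refine ⟨∅, ?_⟩
    ext B
    simp only [Finset.mem_filter, Finset.mem_univ, true_and, Finset.card_eq_zero,
      Finset.mem_singleton]
    exact ⟨fun h => h.2, fun hB => ⟨hB ▸ h.face_empty, hB⟩⟩
  | succ i =>
    have : {F | F ∈ faceComplex a Face ∧ F.Nonempty ∧ dim F = i} =
        (fun B : Finset σ => convexHull ℝ (realPoint a '' (B : Set σ))) ''
          ((Finset.univ.filter fun B : Finset σ => Face B ∧ B.card = i + 1 : Finset (Finset σ)) :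
            Set (Finset σ)) := by
      ext F
      simp only [Set.mem_ofPred_eq, Set.mem_image, Finset.coe_filter, Finset.mem_univ, true_and]
      constructor
      · rintro ⟨⟨B, hB, rfl⟩, hne, hd⟩
        have hBne : B.Nonempty := by
          rw [convexHull_nonempty_iff, Set.image_nonempty] at hne
          exact_mod_cast hne
        obtain ⟨k, hk⟩ : ∃ k, B.card = k + 1 :=
          ⟨B.card - 1, by have := hBne.card_pos; omega⟩
        rw [h.dim_convexHull hB hk] at hd
        exact ⟨B, ⟨hB, by rw [hk, hd]⟩, rfl⟩
      · rintro ⟨B, ⟨hB, hk⟩, rfl⟩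
        have hBne : B.Nonempty := Finset.card_pos.mp (by omega)
        exact ⟨⟨B, hB, rfl⟩, by simpa using hBne, h.dim_convexHull hB hk⟩
    rw [faceNumber, this, Set.InjOn.ncard_image, Set.ncard_coe_finset]
    intro B hB C hC hBC
    have hB : Face B := by simp at hB; exact hB.1
    have hC : Face C := by simp at hC; exact hC.1
    exact (h.subset_of_convexHull_subset hB hC (le_of_eq hBC)).antisymm
      (h.subset_of_convexHull_subset hC hB (ge_of_eq hBC))

theorem hPolynomial_eq (h : IsUnimodularSystem a Face) :
    hPolynomial (convexHull ℝ (Set.range (realPoint a))) (faceComplex a Face) =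
      ∑ B ∈ Finset.univ.filter Face, X ^ B.card * (1 - X) ^ (Fintype.card ι + 1 - B.card) := by
  rw [hPolynomial, h.dim_polytope, ← Finset.sum_fiberwise_of_maps_to
    (g := fun B : Finset σ => B.card) (t := Finset.range (Fintype.card ι + 2))]
  · refine Finset.sum_congr rfl fun i _ => ?_
    rw [h.faceNumber_eq, Finset.filter_filter, mul_assoc, ← nsmul_eq_mul, ← Finset.sum_const]
    refine Finset.sum_congr rfl fun B hB => ?_
    rw [(Finset.mem_filter.mp hB).2.2]
  · intro B hB
    have := h.card_le (Finset.mem_filter.mp hB).2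
    simp only [Finset.mem_range]
    omega

theorem hPolynomial_eval_one (h : IsUnimodularSystem a Face) :
    (hPolynomial (convexHull ℝ (Set.range (realPoint a))) (faceComplex a Face)).eval 1 =
      (Finset.univ.filter fun C => Face C ∧ C.card = Fintype.card ι + 1).card := by
  rw [h.hPolynomial_eq, eval_finsetSum, ← Finset.filter_filter, Finset.card_filter,
    Nat.cast_sum]
  refine Finset.sum_congr rfl fun B hB => ?_
  have := h.card_le (Finset.mem_filter.mp hB).2
  by_cases hc : B.card = Fintype.card ι + 1
  · simp [hc]
  · have : Fintype.card ι + 1 - B.card ≠ 0 := by omega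
    simp [hc, this]

open MeasureTheory in
theorem normalizedVolume_eq_card [Nonempty ι] (h : IsUnimodularSystem a Face) :
    normalizedVolume (convexHull ℝ (Set.range (realPoint a))) =
      (Finset.univ.filter fun C => Face C ∧ C.card = Fintype.card ι + 1).card := by
  have hclosed (C : Finset σ) : IsCompact (convexHull ℝ (realPoint a '' (C : Set σ))) :=
    ((C.finite_toSet).image (realPoint a)).isCompact_convexHull (𝕜 := ℝ)
  have hvol : volume.real (convexHull ℝ (Set.range (realPoint a))) =
      ∑ C ∈ Finset.univ.filter fun C => Face C ∧ C.card = Fintype.card ι + 1,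
        volume.real (convexHull ℝ (realPoint a '' (C : Set σ))) := by
    rw [← h.iUnion_convexHull_eq, measureReal_def, measure_biUnion_finset₀, ENNReal.toReal_sum]
    · rfl
    · exact fun C _ => (hclosed C).measure_lt_top.ne
    · intro B hB C hC hne
      obtain ⟨hB, hBc⟩ : Face B ∧ B.card = Fintype.card ι + 1 := by simpa using hB
      obtain ⟨hC, hCc⟩ : Face C ∧ C.card = Fintype.card ι + 1 := by simpa using hC
      refine measure_mono_null (h.convexHull_inter_subset hB hC) ?_
      have hlt : (B ∩ C).card < Fintype.card ι + 1 := by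
        rw [← hBc]
        refine Finset.card_lt_card ⟨Finset.inter_subset_left, fun hsub => hne ?_⟩
        exact Finset.eq_of_subset_of_card_le (fun s hs => (Finset.mem_inter.mp (hsub hs)).2)
          (by omega)
      rcases Nat.eq_zero_or_pos (B ∩ C).card with h0 | h0
      · rw [Finset.card_eq_zero.mp h0]
        simp
      · obtain ⟨k, hk⟩ : ∃ k, (B ∩ C).card = k + 1 := ⟨_, (Nat.succ_pred_eq_of_pos h0).symm⟩
        have hd := h.dim_convexHull (h.down_closed hB Finset.inter_subset_left) hk
        refine measure_mono_null (subset_affineSpan ℝ _)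
          (Measure.addHaar_affineSubspace _ _ fun htop => ?_)
        rw [dim, ← direction_affineSpan, htop, AffineSubspace.direction_top, finrank_top,
          Module.finrank_pi] at hd
        omega
    · exact fun C _ => (hclosed C).isClosed.measurableSet.nullMeasurableSet
  rw [normalizedVolume, normalizedVolumeIn, hvol, Finset.mul_sum, Finset.sum_div,
    Finset.cast_card]
  refine Finset.sum_congr rfl fun C hC => ?_
  obtain ⟨hC, hCc⟩ : Face C ∧ C.card = Fintype.card ι + 1 := by simpa using hC
  exact h.normalizedVolumeIn_face hC hCc

end IsUnimodularSystem
end LatticePolytope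

namespace LatticePolytope

open scoped Classical

variable {σ ι : Type*} [Fintype σ]

/-- The exponent vectors of degree `k` supported on a face. -/
def standardExponents (Face : Finset σ → Prop) (k : ℕ) : Set (σ →₀ ℕ) :=
  {u | Face u.support ∧ ∑ s, u s = k}

theorem one_sub_X_mul_mk_pos :
    (1 - PowerSeries.X : PowerSeries ℤ) * PowerSeries.mk (fun n => if n = 0 then 0 else 1) =
      PowerSeries.X := by
  ext n
  rw [sub_mul, one_mul, map_sub]
  rcases n with _ | _ | n <;> simp [PowerSeries.coeff_succ_X_mul, PowerSeries.coeff_X]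

theorem coeff_mk_pos_pow (B : Finset σ) (k : ℕ) :
    PowerSeries.coeff k
      ((PowerSeries.mk (fun n => if n = 0 then 0 else 1) : PowerSeries ℤ) ^ B.card) =
      {u : σ →₀ ℕ | u.support = B ∧ ∑ s, u s = k}.ncard := by
  have hset : {u : σ →₀ ℕ | u.support = B ∧ ∑ s, u s = k} =
      ((B.finsuppAntidiag k).filter fun u => u.support = B : Finset (σ →₀ ℕ)) := by
    ext u
    simp only [Set.mem_ofPred_eq, Finset.coe_filter, Finset.mem_finsuppAntidiag]
    constructor
    · rintro ⟨h1, h2⟩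
      refine ⟨⟨?_, h1.le⟩, h1⟩
      rw [← h2, Finset.sum_subset (Finset.subset_univ B)]
      intro s _ hs
      rw [← h1] at hs
      simpa using hs
    · rintro ⟨⟨h2, -⟩, h1⟩
      refine ⟨h1, ?_⟩
      rw [← h2, eq_comm, Finset.sum_subset (Finset.subset_univ B)]
      intro s _ hs
      rw [← h1] at hs
      simpa using hs
  rw [hset, Set.ncard_coe_finset, ← Finset.prod_const, PowerSeries.coeff_prod, Finset.card_filter,
    Nat.cast_sum]
  refine Finset.sum_congr rfl fun u hu => ?_
  have hu := (Finset.mem_finsuppAntidiag.mp hu).2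
  by_cases h : u.support = B
  · rw [if_pos h, Finset.prod_eq_one]
    · simp
    · intro s hs
      rw [← h] at hs
      simpa using hs
  · rw [if_neg h]
    obtain ⟨s, hs, hs'⟩ : ∃ s ∈ B, s ∉ u.support := by
      by_contra! hB
      exact h (hu.antisymm hB)
    rw [Finset.prod_eq_zero hs]
    · simp
    · simpa using hs'

theorem finite_degree_eq (k : ℕ) : {u : σ →₀ ℕ | ∑ s, u s = k}.Finite := by
  refine (Finset.finite_toSet (Finset.univ.finsuppAntidiag k)).subset fun u hu => ?_
  simpa using hu

theorem ncard_standardExponents (Face : Finset σ → Prop) (k : ℕ) :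
    ((standardExponents Face k).ncard : ℤ) =
      ∑ B ∈ Finset.univ.filter Face, PowerSeries.coeff k
        ((PowerSeries.mk (fun n => if n = 0 then 0 else 1) : PowerSeries ℤ) ^ B.card) := by
  simp only [coeff_mk_pos_pow, ← Nat.cast_sum]
  congr 1
  have hfin (B : Finset σ) : {u : σ →₀ ℕ | u.support = B ∧ ∑ s, u s = k}.Finite :=
    (finite_degree_eq k).subset fun u hu => hu.2
  have hS : (standardExponents Face k).Finite := (finite_degree_eq k).subset fun u hu => hu.2
  rw [Set.ncard_eq_toFinset_card _ hS, Finset.card_eq_sum_card_fiberwise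
    (f := fun u : σ →₀ ℕ => u.support) (t := Finset.univ.filter Face)]
  · refine Finset.sum_congr rfl fun B hB => ?_
    rw [Set.ncard_eq_toFinset_card _ (hfin B)]
    congr 1
    ext u
    have hB := (Finset.mem_filter.mp hB).2
    simp only [standardExponents, Finset.mem_filter, Set.Finite.mem_toFinset, Set.mem_ofPred_eq]
    constructor
    · rintro ⟨⟨-, h2⟩, h3⟩
      exact ⟨h3, h2⟩
    · rintro ⟨h3, h2⟩
      exact ⟨⟨h3 ▸ hB, h2⟩, h3⟩
  · intro u hu
    have hu : u ∈ standardExponents Face k := by simpa using hu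
    simpa using hu.1

namespace IsUnimodularSystem

variable [Fintype ι] {a : σ → ι → ℤ} {Face : Finset σ → Prop}

theorem ehrhart_eq (h : IsUnimodularSystem a Face) {k : ℕ} (hk : k ≠ 0) :
    ehrhart (convexHull ℝ (Set.range (realPoint a))) k = (standardExponents Face k).ncard := by
  have hk' : (k : ℝ) ≠ 0 := by exact_mod_cast hk
  have hsupp (u : σ →₀ ℕ) : supp (fun s => (u s : ℝ)) = u.support := by
    ext s
    simp [mem_supp]
  rw [ehrhart, columnLattice_convexHull h.zero_or_one, columns_convexHull h.zero_or_one]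
  refine (Set.ncard_congr (fun (u : σ →₀ ℕ) _ => columnSum a fun s => (u s : ℝ)) ?_ ?_ ?_).symm
  · rintro u ⟨hu, hsum⟩
    refine ⟨⟨columnSum a fun s => (u s : ℝ) / k, ?_, ?_⟩,
      columnSum_mem_span a fun s => ⟨u s, by simp⟩⟩
    · rw [mem_convexHull_range_iff]
      refine ⟨_, fun s => by positivity, ?_, rfl⟩
      rw [← Finset.sum_div, ← Nat.cast_sum, hsum, div_self hk']
    · simp only [columnSum, Finset.smul_sum, smul_smul, mul_div_cancel₀ _ hk']
  · rintro u v ⟨hu, -⟩ ⟨hv, -⟩ huv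
    have := h.unique (c := fun s => (u s : ℝ)) (d := fun s => (v s : ℝ))
      (fun s => by positivity) (fun s => by positivity) (by rwa [hsupp]) (by rwa [hsupp]) huv
    ext s
    exact_mod_cast congrFun this s
  · rintro x ⟨⟨y, hy, rfl⟩, hx⟩
    obtain ⟨w, hw, hw1, rfl⟩ := (mem_convexHull_range_iff _ _).mp hy
    obtain ⟨d, hd, hdF, hsum⟩ := h.exists_rep (fun s => k * w s) fun s =>
      mul_nonneg (Nat.cast_nonneg k) (hw s)
    have hkw : columnSum a (fun s => k * w s) = (k : ℝ) • ∑ s, w s • column a s := by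
      simp only [columnSum, Finset.smul_sum, smul_smul]
    have hint := h.integral d hd hdF (by rw [← hsum, hkw]; exact hx)
    choose z hz using hint
    have hz0 (s : σ) : 0 ≤ z s := by
      have := hd s
      rw [hz] at this
      exact_mod_cast this
    have hd' : d =
        fun s => ((Finsupp.equivFunOnFinite.symm fun s => (z s).toNat : σ →₀ ℕ) s : ℝ) := by
      funext s
      rw [hz, Finsupp.equivFunOnFinite_symm_apply_apply]
      exact_mod_cast (Int.toNat_of_nonneg (hz0 s)).symm
    refine ⟨Finsupp.equivFunOnFinite.symm fun s => (z s).toNat, ⟨?_, ?_⟩, ?_⟩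
    · rw [← hsupp, ← hd']
      exact hdF
    · have h2 := congrArg Prod.snd hsum
      rw [columnSum_snd, columnSum_snd, ← Finset.mul_sum, hw1, mul_one, hd'] at h2
      refine Nat.cast_injective (R := ℝ) ?_
      rw [Nat.cast_sum]
      exact h2.symm
    · rw [← hd', ← hsum, hkw]

theorem hStar_eq (h : IsUnimodularSystem a Face) :
    hStar (convexHull ℝ (Set.range (realPoint a))) =
      (hPolynomial (convexHull ℝ (Set.range (realPoint a))) (faceComplex a Face) :
        PowerSeries ℤ) := by
  have hmk : (PowerSeries.mk fun m => if m = 0 then 1 else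
      (ehrhart (convexHull ℝ (Set.range (realPoint a))) m : ℤ)) =
      ∑ B ∈ Finset.univ.filter Face,
        (PowerSeries.mk (fun n => if n = 0 then 0 else 1) : PowerSeries ℤ) ^ B.card := by
    ext k
    rw [PowerSeries.coeff_mk, map_sum, ← ncard_standardExponents]
    split_ifs with hk
    · subst hk
      have : standardExponents Face 0 = {0} := by
        ext u
        simp only [standardExponents, Set.mem_ofPred_eq, Set.mem_singleton_iff]
        constructor
        · rintro ⟨-, h0⟩
          ext s
          exact Finset.sum_eq_zero_iff.mp h0 s (Finset.mem_univ s)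
        · rintro rfl
          exact ⟨by simpa using h.face_empty, by simp⟩
      simp [this]
    · rw [h.ehrhart_eq hk]
  rw [hStar, hmk, h.dim_polytope, h.hPolynomial_eq, Finset.mul_sum]
  have hcoe (f : Finset σ → ℤ[X]) (S : Finset (Finset σ)) :
      ((∑ B ∈ S, f B : ℤ[X]) : PowerSeries ℤ) = ∑ B ∈ S, (f B : PowerSeries ℤ) :=
    map_sum Polynomial.coeToPowerSeries.ringHom f S
  rw [hcoe]
  refine Finset.sum_congr rfl fun B hB => ?_
  have hle := h.card_le (Finset.mem_filter.mp hB).2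
  rw [Polynomial.coe_mul, Polynomial.coe_pow, Polynomial.coe_pow, Polynomial.coe_sub,
    Polynomial.coe_one, Polynomial.coe_X]
  nth_rewrite 1 [← Nat.sub_add_cancel hle]
  rw [pow_add, mul_assoc, ← mul_pow, one_sub_X_mul_mk_pos, mul_comm]

end IsUnimodularSystem
end LatticePolytope

/-! ### Initial complexes of toric ideals -/

open scoped MonomialOrder

section Toric

variable {K : Type*} [Field K] {σ M : Type*} [AddCommGroup M]

/-- The weight `∑ u_s A_s` of the monomial with exponent vector `u`. -/
def monomialWeight (A : σ → M) : (σ →₀ ℕ) →+ M :=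
  Finsupp.liftAddHom fun s => (multiplesHom M) (A s)

theorem monomialWeight_single (A : σ → M) (s : σ) :
    monomialWeight A (Finsupp.single s 1) = A s := by
  simp [monomialWeight]

theorem monomialWeight_eq_sum [Fintype σ] (A : σ → M) (u : σ →₀ ℕ) :
    monomialWeight A u = ∑ s, u s • A s := by
  simp only [monomialWeight, Finsupp.liftAddHom_apply]
  exact Finsupp.sum_fintype _ _ fun s => zero_nsmul _

theorem aeval_single_monomial (A : σ → M) (u : σ →₀ ℕ) (c : K) :
    MvPolynomial.aeval (R := K) (fun s => (AddMonoidAlgebra.single (A s) 1 : AddMonoidAlgebra K M))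
      (MvPolynomial.monomial u c) = AddMonoidAlgebra.single (monomialWeight A u) c := by
  induction u using Finsupp.induction_linear generalizing c with
  | zero =>
    rw [map_zero, ← MvPolynomial.C_apply, MvPolynomial.aeval_C]
    rfl
  | add u v hu hv =>
    have : MvPolynomial.monomial (u + v) c =
        MvPolynomial.monomial u c * MvPolynomial.monomial v 1 := by
      rw [MvPolynomial.monomial_mul, mul_one]
    rw [this, map_mul, hu, hv, AddMonoidAlgebra.single_mul_single, mul_one, map_add]
  | single s k =>
    rw [MvPolynomial.aeval_monomial, Finsupp.prod_single_index (by exact pow_zero _),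
      AddMonoidAlgebra.single_pow, one_pow, ← Algebra.smul_def, AddMonoidAlgebra.smul_single]
    simp [monomialWeight]

theorem binomial_mem_toricIdeal (A : σ → M) {u v : σ →₀ ℕ}
    (huv : monomialWeight A u = monomialWeight A v) :
    MvPolynomial.monomial u (1 : K) - MvPolynomial.monomial v 1 ∈ toricIdeal K A := by
  rw [toricIdeal, RingHom.mem_ker]
  rw [map_sub, aeval_single_monomial, aeval_single_monomial, huv, sub_self]

theorem sum_coeff_eq_zero_of_mem_toricIdeal [DecidableEq M] {A : σ → M} {f : MvPolynomial σ K}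
    (hf : f ∈ toricIdeal K A) (w : M) :
    ∑ u ∈ f.support.filter fun u => monomialWeight A u = w, f.coeff u = 0 := by
  rw [toricIdeal, RingHom.mem_ker] at hf
  rw [f.as_sum, map_sum] at hf
  simp only [aeval_single_monomial] at hf
  have := congrArg (fun g : AddMonoidAlgebra K M => g.coeff w) hf
  simp only [AddMonoidAlgebra.coeff_sum, AddMonoidAlgebra.coeff_single, Finsupp.finsetSum_apply,
    Finsupp.single_apply] at this
  rw [Finset.sum_filter]
  exact this

theorem monomial_mem_initialIdeal (m : MonomialOrder σ) (A : σ → M) {u v : σ →₀ ℕ}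
    (huv : monomialWeight A u = monomialWeight A v) (hlt : v ≺[m] u) :
    MvPolynomial.monomial u (1 : K) ∈ initialIdeal m (toricIdeal K A) := by
  classical
  have hdeg : m.degree (MvPolynomial.monomial u (1 : K) - MvPolynomial.monomial v 1) = u := by
    rw [MonomialOrder.degree_sub_of_lt] <;> simp [MonomialOrder.degree_monomial, hlt]
  refine Ideal.subset_span ⟨_, binomial_mem_toricIdeal A huv, fun h0 => ?_, by rw [hdeg]⟩
  have := (MvPolynomial.monomial_left_injective (one_ne_zero : (1 : K) ≠ 0)) (sub_eq_zero.mp h0)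
  rw [this] at hlt
  exact lt_irrefl _ hlt

theorem monomial_mem_initialIdeal_iff (m : MonomialOrder σ) (I : Ideal (MvPolynomial σ K))
    (u : σ →₀ ℕ) :
    MvPolynomial.monomial u (1 : K) ∈ initialIdeal m I ↔
      ∃ f ∈ I, f ≠ 0 ∧ m.degree f ≤ u := by
  have : {g | ∃ f ∈ I, f ≠ 0 ∧ g = MvPolynomial.monomial (m.degree f) 1} =
      (fun s => MvPolynomial.monomial s (1 : K)) '' {d | ∃ f ∈ I, f ≠ 0 ∧ d = m.degree f} := by
    ext g
    constructor
    · rintro ⟨f, hf, hf0, rfl⟩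
      exact ⟨_, ⟨f, hf, hf0, rfl⟩, rfl⟩
    · rintro ⟨_, ⟨f, hf, hf0, rfl⟩, rfl⟩
      exact ⟨f, hf, hf0, rfl⟩
  rw [initialIdeal, this, MvPolynomial.mem_ideal_span_monomial_image]
  classical
  rw [MvPolynomial.support_monomial, if_neg one_ne_zero]
  simp only [Finset.mem_singleton, forall_eq]
  constructor
  · rintro ⟨_, ⟨f, hf, hf0, rfl⟩, hle⟩
    exact ⟨f, hf, hf0, hle⟩
  · rintro ⟨f, hf, hf0, hle⟩
    exact ⟨_, ⟨f, hf, hf0, rfl⟩, hle⟩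

/-- The exponent vector of a squarefree monomial. -/
def squarefreeExponent (B : Finset σ) : σ →₀ ℕ := ∑ s ∈ B, Finsupp.single s 1

theorem squarefreeExponent_apply [DecidableEq σ] (B : Finset σ) (s : σ) :
    squarefreeExponent B s = if s ∈ B then 1 else 0 := by
  rw [squarefreeExponent, Finsupp.finsetSum_apply]
  simp [Finsupp.single_apply]

theorem prod_X_eq (B : Finset σ) : ∏ s ∈ B, (MvPolynomial.X s : MvPolynomial σ K) =
    MvPolynomial.monomial (squarefreeExponent B) 1 := by
  rw [squarefreeExponent, MvPolynomial.monomial_sum_one]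
  rfl

end Toric

namespace LatticePolytope.IsUnimodularSystem

open scoped Classical

variable {K : Type*} [Field K] {σ ι : Type*} [Fintype σ] {a : σ → ι → ℤ}
  {Face : Finset σ → Prop}

theorem columnSum_eq_of_weight_eq {u v : σ →₀ ℕ}
    (huv : monomialWeight (fun s => (a s, (1 : ℤ))) u =
      monomialWeight (fun s => (a s, (1 : ℤ))) v) :
    columnSum a (fun s => (u s : ℝ)) = columnSum a (fun s => (v s : ℝ)) := by
  have key (u : σ →₀ ℕ) : columnSum a (fun s => (u s : ℝ)) =
      ((fun i => ((monomialWeight (fun s => (a s, (1 : ℤ))) u).1 i : ℝ)),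
        ((monomialWeight (fun s => (a s, (1 : ℤ))) u).2 : ℝ)) := by
    rw [monomialWeight_eq_sum]
    refine columnSum_eq_mk a ?_ ?_
    · funext i
      simp [Prod.fst_sum, realPoint]
    · simp [Prod.snd_sum]
  rw [key, key, huv]

variable [Fintype ι]

theorem standard_unique (h : IsUnimodularSystem a Face) {u v : σ →₀ ℕ} (hu : Face u.support)
    (hv : Face v.support)
    (huv : monomialWeight (fun s => (a s, (1 : ℤ))) u =
      monomialWeight (fun s => (a s, (1 : ℤ))) v) : u = v := by
  have hsupp (u : σ →₀ ℕ) : supp (fun s => (u s : ℝ)) = u.support := by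
    ext s
    simp [mem_supp]
  have := h.unique (fun s => Nat.cast_nonneg (u s)) (fun s => Nat.cast_nonneg (v s))
    (by rwa [hsupp]) (by rwa [hsupp]) (columnSum_eq_of_weight_eq huv)
  ext s
  exact_mod_cast congrFun this s

theorem standard_le (h : IsUnimodularSystem a Face) (m : MonomialOrder σ)
    (hred : ∀ B, ¬ Face B → ∃ v, monomialWeight (fun s => (a s, (1 : ℤ))) v =
      monomialWeight (fun s => (a s, (1 : ℤ))) (squarefreeExponent B) ∧
        v ≺[m] squarefreeExponent B) {u : σ →₀ ℕ} (hu : Face u.support) (v : σ →₀ ℕ)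
    (hv : monomialWeight (fun s => (a s, (1 : ℤ))) v =
      monomialWeight (fun s => (a s, (1 : ℤ))) u) : u ≼[m] v := by
  induction v using (InvImage.wf m.toSyn (wellFounded_lt)).induction with
  | _ v ih =>
  by_cases hF : Face v.support
  · rw [h.standard_unique hu hF hv.symm]
  · obtain ⟨r, hr, hlt⟩ := hred _ hF
    have hle : squarefreeExponent v.support ≤ v := by
      intro s
      rw [squarefreeExponent_apply]
      split_ifs with hs
      · exact Nat.one_le_iff_ne_zero.mpr (Finsupp.mem_support_iff.mp hs)
      · exact Nat.zero_le _
    obtain ⟨t, ht⟩ := exists_add_of_le hle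
    have hlt' : m.toSyn (r + t) < m.toSyn v := by
      conv_rhs => rw [ht]
      rw [map_add, map_add]
      exact add_lt_add_left hlt _
    refine (ih (r + t) hlt' ?_).trans hlt'.le
    rw [← hv]
    conv_rhs => rw [ht]
    rw [map_add, map_add, hr]

theorem prod_mem_radical_iff (h : IsUnimodularSystem a Face) (m : MonomialOrder σ)
    (hred : ∀ B, ¬ Face B → ∃ v, monomialWeight (fun s => (a s, (1 : ℤ))) v =
      monomialWeight (fun s => (a s, (1 : ℤ))) (squarefreeExponent B) ∧
        v ≺[m] squarefreeExponent B) (B : Finset σ) :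
    ∏ s ∈ B, (MvPolynomial.X s : MvPolynomial σ K) ∉
      (initialIdeal m (toricIdeal K fun s => (a s, (1 : ℤ)))).radical ↔ Face B := by
  rw [prod_X_eq]
  constructor
  · contrapose!
    intro hB
    obtain ⟨v, hv, hlt⟩ := hred B hB
    exact Ideal.le_radical (monomial_mem_initialIdeal m _ hv.symm hlt)
  · rintro hB ⟨n, hn⟩
    rw [MvPolynomial.monomial_pow, one_pow, monomial_mem_initialIdeal_iff] at hn
    obtain ⟨f, hf, hf0, hle⟩ := hn
    have hF : Face (m.degree f).support := by
      refine h.down_closed hB fun s hs => ?_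
      by_contra hsB
      have := hle s
      rw [Finsupp.smul_apply, squarefreeExponent_apply, if_neg hsB, smul_zero] at this
      exact Finsupp.mem_support_iff.mp hs (Nat.le_zero.mp this)
    have hsum := sum_coeff_eq_zero_of_mem_toricIdeal hf
      (monomialWeight (fun s => (a s, (1 : ℤ))) (m.degree f))
    rw [Finset.sum_eq_single (m.degree f)] at hsum
    · exact m.coeff_degree_ne_zero_iff.mpr hf0 hsum
    · intro v hv hne
      obtain ⟨hv, hw⟩ := Finset.mem_filter.mp hv
      exact absurd (m.toSyn.injective ((m.le_degree hv).antisymm (h.standard_le m hred hF v hw)))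
        hne
    · intro hnot
      by_contra hne
      exact hnot (Finset.mem_filter.mpr ⟨MvPolynomial.mem_support_iff.mpr hne, rfl⟩)

theorem initialComplex_eq (h : IsUnimodularSystem a Face) (m : MonomialOrder σ)
    (hred : ∀ B, ¬ Face B → ∃ v, monomialWeight (fun s => (a s, (1 : ℤ))) v =
      monomialWeight (fun s => (a s, (1 : ℤ))) (squarefreeExponent B) ∧
        v ≺[m] squarefreeExponent B) :
    initialComplex K m a = faceComplex a Face := by
  ext F
  exact exists_congr fun B => and_congr_left fun _ => h.prod_mem_radical_iff m hred B

end LatticePolytope.IsUnimodularSystem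

/-! ### Eulerian polynomials and chains of subsets -/

namespace EulerianChain

open scoped Classical

variable {m : ℕ}

/-- `C` is a chain of nonempty proper subsets. -/
def IsProperChain {α : Type*} [Fintype α] (C : Finset (Finset α)) : Prop :=
  (∀ S ∈ C, S ≠ ∅ ∧ S ≠ Finset.univ) ∧ ∀ S ∈ C, ∀ T ∈ C, S ⊆ T ∨ T ⊆ S

/-- The positions of the descents of `w`. -/
def descents (w : Equiv.Perm (Fin m)) : Finset (Fin m) :=
  Finset.univ.filter fun i : Fin m => ∃ j : Fin m, (j : ℕ) = i + 1 ∧ w j < w i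

/-- The positions at which descents can occur. -/
def positions (m : ℕ) : Finset (Fin m) := Finset.univ.filter fun i => (i : ℕ) + 1 < m

/-- The set of the values of `w` at the positions up to `i`. -/
def initialSegment (w : Equiv.Perm (Fin m)) (i : Fin m) : Finset (Fin m) :=
  (Finset.Iic i).map w.toEmbedding

theorem mem_initialSegment {w : Equiv.Perm (Fin m)} {i x : Fin m} :
    x ∈ initialSegment w i ↔ w.symm x ≤ i := by
  simp [initialSegment]

theorem apply_mem_initialSegment {w : Equiv.Perm (Fin m)} {i j : Fin m} :
    w j ∈ initialSegment w i ↔ j ≤ i := by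
  simp [mem_initialSegment]

theorem card_initialSegment (w : Equiv.Perm (Fin m)) (i : Fin m) :
    (initialSegment w i).card = i + 1 := by
  simp [initialSegment]

theorem initialSegment_injective (w : Equiv.Perm (Fin m)) :
    Function.Injective (initialSegment w) := by
  intro i j h
  have := congrArg Finset.card h
  rw [card_initialSegment, card_initialSegment] at this
  omega

theorem eq_initialSegment {w : Equiv.Perm (Fin m)} {T : Finset (Fin m)} {i : Fin m}
    (hT : ∀ x ∈ T, ∀ y ∉ T, w.symm x < w.symm y) (hc : T.card = i + 1) :
    T = initialSegment w i := by
  by_cases h : T ⊆ initialSegment w i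
  · exact Finset.eq_of_subset_of_card_le h (by rw [card_initialSegment, hc])
  · obtain ⟨x, hx, hx'⟩ := Finset.not_subset.mp h
    rw [mem_initialSegment] at hx'
    refine (Finset.eq_of_subset_of_card_le (fun y hy => ?_)
      (by rw [card_initialSegment, hc])).symm
    by_contra hyT
    exact hx' ((hT x hx y hyT).le.trans (mem_initialSegment.mp hy))

theorem descents_subset_positions (w : Equiv.Perm (Fin m)) : descents w ⊆ positions m := by
  intro i hi
  obtain ⟨j, hj, -⟩ := (Finset.mem_filter.mp hi).2
  exact Finset.mem_filter.mpr ⟨Finset.mem_univ _, by omega⟩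

theorem card_positions (m : ℕ) : (positions m).card = m - 1 := by
  rcases m with _ | m
  · simp [positions]
  · have : positions (m + 1) = Finset.univ.erase (Fin.last m) := by
      ext i
      simp only [positions, Finset.mem_filter, Finset.mem_univ, true_and, Finset.mem_erase,
        and_true, ne_eq, Fin.ext_iff, Fin.val_last]
      omega
    rw [this, Finset.card_erase_of_mem (Finset.mem_univ _)]
    simp

/-- The number of members of the chain that do not contain `x`. -/
def level (C : Finset (Finset (Fin m))) (x : Fin m) : ℕ := (C.filter fun S => x ∉ S).card

theorem level_lt {C : Finset (Finset (Fin m))} (hC : IsProperChain C) {S : Finset (Fin m)}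
    (hS : S ∈ C) {x y : Fin m} (hx : x ∈ S) (hy : y ∉ S) : level C x < level C y := by
  refine Finset.card_lt_card ⟨fun T hT => ?_, fun h => ?_⟩
  · rw [Finset.mem_filter] at hT ⊢
    refine ⟨hT.1, fun hyT => ?_⟩
    rcases hC.2 S hS T hT.1 with h | h
    exacts [hT.2 (h hx), hy (h hyT)]
  · exact (Finset.mem_filter.mp (h (Finset.mem_filter.mpr ⟨hS, hy⟩))).2 hx

theorem exists_of_level_lt {C : Finset (Finset (Fin m))} {x y : Fin m}
    (h : level C x < level C y) : ∃ S ∈ C, x ∈ S ∧ y ∉ S := by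
  by_contra! hne
  refine absurd (Finset.card_le_card fun S hS => ?_) (not_le.mpr h)
  rw [Finset.mem_filter] at hS ⊢
  exact ⟨hS.1, fun hx => hS.2 (hne S hS.1 hx)⟩

/-- The permutation that sorts the ground set along the chain. -/
def chainPerm (C : Finset (Finset (Fin m))) : Equiv.Perm (Fin m) := Tuple.sort (level C)

/-- The positions at which the members of the chain end. -/
def chainPositions (C : Finset (Finset (Fin m))) : Finset (Fin m) :=
  Finset.univ.filter fun i => ∃ S ∈ C, S.card = (i : ℕ) + 1

theorem eq_initialSegment_chainPerm {C : Finset (Finset (Fin m))} (hC : IsProperChain C)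
    {S : Finset (Fin m)} (hS : S ∈ C) {i : Fin m} (hc : S.card = i + 1) :
    S = initialSegment (chainPerm C) i := by
  refine eq_initialSegment (fun x hx y hy => ?_) hc
  by_contra! h
  have h1 := Tuple.monotone_sort (level C) h
  simp only [Function.comp_apply] at h1
  rw [← chainPerm, Equiv.apply_symm_apply, Equiv.apply_symm_apply] at h1
  exact absurd (level_lt hC hS hx hy) (not_lt.mpr h1)

theorem exists_card_eq {C : Finset (Finset (Fin m))} (hC : IsProperChain C)
    {S : Finset (Fin m)} (hS : S ∈ C) : ∃ i : Fin m, S.card = i + 1 ∧ (i : ℕ) + 1 < m := by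
  have h1 := Finset.card_pos.mpr (Finset.nonempty_iff_ne_empty.mpr (hC.1 S hS).1)
  have h2 : S.card < m := by
    have := Finset.card_lt_card (Finset.ssubset_univ_iff.mpr (hC.1 S hS).2)
    simpa using this
  exact ⟨⟨S.card - 1, by omega⟩, by simp only; omega, by simp only; omega⟩

theorem descents_chainPerm_subset {C : Finset (Finset (Fin m))} (hC : IsProperChain C) :
    descents (chainPerm C) ⊆ chainPositions C := by
  intro i hi
  obtain ⟨j, hj, hlt⟩ := (Finset.mem_filter.mp hi).2
  have hij : i < j := by rw [Fin.lt_def]; omega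
  obtain ⟨hmono, htie⟩ := Tuple.eq_sort_iff.mp (rfl : chainPerm C = Tuple.sort (level C))
  have hlev : level C (chainPerm C i) < level C (chainPerm C j) :=
    lt_of_le_of_ne (hmono hij.le) fun h => absurd (htie i j hij h) (not_lt.mpr hlt.le)
  obtain ⟨S, hS, hSi, hSj⟩ := exists_of_level_lt hlev
  obtain ⟨k, hk, -⟩ := exists_card_eq hC hS
  rw [eq_initialSegment_chainPerm hC hS hk, apply_mem_initialSegment] at hSi hSj
  refine Finset.mem_filter.mpr ⟨Finset.mem_univ _, S, hS, ?_⟩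
  rw [Fin.le_def] at hSi hSj
  omega

theorem chainPositions_subset {C : Finset (Finset (Fin m))} (hC : IsProperChain C) :
    chainPositions C ⊆ positions m := by
  intro i hi
  obtain ⟨S, hS, hc⟩ := (Finset.mem_filter.mp hi).2
  obtain ⟨j, hj, hj'⟩ := exists_card_eq hC hS
  exact Finset.mem_filter.mpr ⟨Finset.mem_univ _, by omega⟩

theorem image_initialSegment_chainPerm {C : Finset (Finset (Fin m))} (hC : IsProperChain C) :
    (chainPositions C).image (initialSegment (chainPerm C)) = C := by
  ext S
  rw [Finset.mem_image]
  constructor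
  · rintro ⟨i, hi, rfl⟩
    obtain ⟨S, hS, hc⟩ := (Finset.mem_filter.mp hi).2
    rwa [← eq_initialSegment_chainPerm hC hS hc]
  · intro hS
    obtain ⟨i, hi, -⟩ := exists_card_eq hC hS
    exact ⟨i, Finset.mem_filter.mpr ⟨Finset.mem_univ _, S, hS, hi⟩,
      (eq_initialSegment_chainPerm hC hS hi).symm⟩

theorem isProperChain_image (w : Equiv.Perm (Fin m)) {R : Finset (Fin m)}
    (hR : R ⊆ positions m) : IsProperChain (R.image (initialSegment w)) := by
  constructor
  · intro S hS
    obtain ⟨i, hi, rfl⟩ := Finset.mem_image.mp hS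
    have hi := (Finset.mem_filter.mp (hR hi)).2
    constructor
    · intro h
      have := congrArg Finset.card h
      rw [card_initialSegment] at this
      simp at this
    · intro h
      have := congrArg Finset.card h
      rw [card_initialSegment] at this
      simp at this
      omega
  · intro S hS T hT
    obtain ⟨i, -, rfl⟩ := Finset.mem_image.mp hS
    obtain ⟨j, -, rfl⟩ := Finset.mem_image.mp hT
    refine (le_total i j).imp (fun h x hx => ?_) fun h x hx => ?_ <;>
      rw [mem_initialSegment] at hx ⊢ <;> exact hx.trans h

theorem chainPositions_image (w : Equiv.Perm (Fin m)) (R : Finset (Fin m)) :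
    chainPositions (R.image (initialSegment w)) = R := by
  ext i
  simp only [chainPositions, Finset.mem_filter, Finset.mem_univ, true_and, Finset.mem_image,
    exists_exists_and_eq_and, card_initialSegment]
  constructor
  · rintro ⟨j, hj, h⟩
    have : j = i := by ext; omega
    exact this ▸ hj
  · exact fun h => ⟨i, h, rfl⟩

theorem apply_lt_of_no_descent {w : Equiv.Perm (Fin m)} {i j : Fin m} (hij : i < j)
    (h : ∀ k, i ≤ k → k < j → k ∉ descents w) : w i < w j := by
  obtain ⟨d, hd⟩ : ∃ d, (j : ℕ) = i + d + 1 := ⟨j - i - 1, by rw [Fin.lt_def] at hij; omega⟩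
  induction d generalizing j with
  | zero =>
    have := h i le_rfl hij
    simp only [descents, Finset.mem_filter, Finset.mem_univ, true_and, not_exists, not_and,
      not_lt] at this
    exact lt_of_le_of_ne (this j (by omega)) fun he => hij.ne (w.injective he)
  | succ d ih =>
    let k : Fin m := ⟨i + d + 1, by omega⟩
    have hik : i < k := by rw [Fin.lt_def]; simp only [k]; omega
    have hkj : k < j := by rw [Fin.lt_def]; simp only [k]; omega
    refine (ih hik (fun l h1 h2 => h l h1 (h2.trans hkj)) rfl).trans ?_
    have := h k hik.le hkj
    simp only [descents, Finset.mem_filter, Finset.mem_univ, true_and, not_exists, not_and,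
      not_lt] at this
    exact lt_of_le_of_ne (this j (by simp only [k]; omega)) fun he => hkj.ne (w.injective he)

theorem chainPerm_image {w : Equiv.Perm (Fin m)} {R : Finset (Fin m)} (hR : descents w ⊆ R)
    (hR' : R ⊆ positions m) : chainPerm (R.image (initialSegment w)) = w := by
  rw [chainPerm, eq_comm, Tuple.eq_sort_iff]
  constructor
  · intro i j hij
    refine Finset.card_le_card fun S hS => ?_
    rw [Finset.mem_filter] at hS ⊢
    refine ⟨hS.1, ?_⟩
    obtain ⟨k, -, rfl⟩ := Finset.mem_image.mp hS.1
    rw [apply_mem_initialSegment] at hS ⊢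
    exact fun h => hS.2 (hij.trans h)
  · intro i j hij heq
    refine apply_lt_of_no_descent hij fun k hik hkj hk => ?_
    refine (level_lt (isProperChain_image w hR') (Finset.mem_image_of_mem _ (hR hk))
      (apply_mem_initialSegment.mpr hik) (y := w j) ?_).ne heq
    rw [apply_mem_initialSegment]
    exact not_le.mpr hkj

theorem sum_Icc_descents (w : Equiv.Perm (Fin m)) :
    ∑ R ∈ Finset.Icc (descents w) (positions m), (X : ℤ[X]) ^ R.card * (1 - X) ^ (m - 1 - R.card) =
      X ^ descentCount w := by
  have hsub := descents_subset_positions w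
  rw [Finset.Icc_eq_image_powerset hsub, Finset.sum_image]
  · have hcard : (positions m \ descents w).card + (descents w).card = m - 1 := by
      rw [Finset.card_sdiff_add_card_eq_card hsub, card_positions]
    have : ∀ R ∈ (positions m \ descents w).powerset,
        (X : ℤ[X]) ^ (descents w ∪ R).card * (1 - X) ^ (m - 1 - (descents w ∪ R).card) =
          X ^ (descents w).card *
            (X ^ R.card * (1 - X) ^ ((positions m \ descents w).card - R.card)) := by
      intro R hR
      rw [Finset.mem_powerset] at hR
      rw [Finset.card_union_of_disjoint
        (Finset.disjoint_of_subset_right hR Finset.disjoint_sdiff), pow_add, mul_assoc]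
      congr 3
      omega
    rw [Finset.sum_congr rfl this, ← Finset.mul_sum, Finset.sum_pow_mul_eq_add_pow,
      add_sub_cancel, one_pow, mul_one, descentCount, descents]
  · intro R hR R' hR' h
    simp only [Finset.coe_powerset, Set.mem_preimage, Set.mem_powerset_iff,
      Finset.coe_subset] at hR hR'
    have hd {R : Finset (Fin m)} (hR : R ⊆ positions m \ descents w) :
        (descents w ∪ R) \ descents w = R := by
      rw [Finset.union_sdiff_left, Finset.sdiff_eq_self_iff_disjoint]
      exact (Finset.disjoint_of_subset_right hR Finset.disjoint_sdiff).symm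
    rw [← hd hR, ← hd hR']
    exact congrArg (· \ descents w) h

/-- The `h`-polynomial of the order complex of the proper part of the Boolean lattice is the
Eulerian polynomial. -/
theorem sum_properChain_eq (m : ℕ) :
    ∑ C ∈ Finset.univ.filter (IsProperChain : Finset (Finset (Fin m)) → Prop),
      (X : ℤ[X]) ^ C.card * (1 - X) ^ (m - 1 - C.card) = eulerianPolynomial m := by
  rw [eulerianPolynomial]
  simp only [← sum_Icc_descents]
  rw [Finset.sum_sigma']
  refine Finset.sum_bij' (fun C _ => ⟨chainPerm C, chainPositions C⟩)
    (fun p _ => p.2.image (initialSegment p.1)) ?_ ?_ ?_ ?_ ?_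
  · intro C hC
    have hC := (Finset.mem_filter.mp hC).2
    simp only [Finset.mem_sigma, Finset.mem_univ, true_and, Finset.mem_Icc]
    exact ⟨descents_chainPerm_subset hC, chainPositions_subset hC⟩
  · rintro ⟨w, R⟩ h
    simp only [Finset.mem_sigma, Finset.mem_univ, true_and, Finset.mem_Icc] at h
    simpa using isProperChain_image w h.2
  · intro C hC
    exact image_initialSegment_chainPerm (Finset.mem_filter.mp hC).2
  · rintro ⟨w, R⟩ h
    simp only [Finset.mem_sigma, Finset.mem_univ, true_and, Finset.mem_Icc] at h
    simp only [chainPositions_image, chainPerm_image h.1 h.2]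
  · intro C hC
    have hC := (Finset.mem_filter.mp hC).2
    conv_lhs => rw [← image_initialSegment_chainPerm hC]
    rw [Finset.card_image_of_injective _ (initialSegment_injective _)]

theorem eulerianPolynomial_eval_one (m : ℕ) :
    (eulerianPolynomial m).eval 1 = (m.factorial : ℤ) := by
  simp [eulerianPolynomial, eval_finsetSum, Fintype.card_perm]

end EulerianChain

/-! ### The cut polytope of `K_{2,m}` -/

namespace CutPolytope

open scoped Classical
open LatticePolytope ChainWeight EulerianChain

variable {m : ℕ}

/-- The part, not containing the first vertex `0`, of an unordered partition. -/
def partOf (p : Bool × Finset (Fin m)) : Finset (Fin 2 ⊕ Fin m) :=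
  Finset.univ.filter fun v => Sum.elim (fun b => b = 1 ∧ p.1 = true) (fun j => j ∈ p.2) v

theorem inl_mem_partOf (p : Bool × Finset (Fin m)) (b : Fin 2) :
    Sum.inl b ∈ partOf p ↔ b = 1 ∧ p.1 = true := by simp [partOf]

theorem inr_mem_partOf (p : Bool × Finset (Fin m)) (j : Fin m) :
    Sum.inr j ∈ partOf p ↔ j ∈ p.2 := by simp [partOf]

theorem partOf_injective : Function.Injective (partOf (m := m)) := by
  rintro ⟨e, S⟩ ⟨e', S'⟩ h
  have h1 := (inl_mem_partOf (e, S) 1).symm.trans ((iff_of_eq (congrArg (Sum.inl 1 ∈ ·) h)).trans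
    (inl_mem_partOf (e', S') 1))
  refine Prod.ext ?_ ?_
  · simpa using h1
  · ext j
    rw [← inr_mem_partOf (e, S), h, inr_mem_partOf]

/-- The unordered partitions of the vertices of `K_{2,m}`. -/
def toPartition : Bool × Finset (Fin m) ≃ UnorderedPartition (Fin 2 ⊕ Fin m) :=
  Equiv.ofBijective (fun p => Quotient.mk (partitionSetoid _) (partOf p)) (by
    constructor
    · intro p q h
      rcases (Quotient.exact h : partOf q = partOf p ∨ partOf q = (partOf p)ᶜ) with h | h
      · exact (partOf_injective h).symm
      · have h1 : Sum.inl 0 ∈ (partOf p)ᶜ := by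
          rw [Finset.mem_compl, inl_mem_partOf]
          simp
        rw [← h, inl_mem_partOf] at h1
        simp at h1
    · intro q
      obtain ⟨A, rfl⟩ := Quotient.exists_rep q
      have key (A : Finset (Fin 2 ⊕ Fin m)) (hA : Sum.inl 0 ∉ A) : ∃ p, partOf p = A := by
        refine ⟨(decide (Sum.inl 1 ∈ A), Finset.univ.filter fun j => Sum.inr j ∈ A), ?_⟩
        ext v
        rcases v with b | j
        · rw [inl_mem_partOf]
          fin_cases b
          · simpa using hA
          · simp
        · rw [inr_mem_partOf]
          simp
      by_cases hA : Sum.inl 0 ∈ A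
      · obtain ⟨p, hp⟩ := key Aᶜ (by simpa using hA)
        exact ⟨p, Quotient.sound (Or.inr (by rw [hp, compl_compl]))⟩
      · obtain ⟨p, hp⟩ := key A hA
        exact ⟨p, Quotient.sound (Or.inl hp.symm)⟩)

/-- The edges of `K_{2,m}`. -/
def edgeEquiv : Fin 2 × Fin m ≃ (completeBipartiteGraph (Fin 2) (Fin m)).edgeSet :=
  Equiv.ofBijective (fun p => ⟨s(Sum.inl p.1, Sum.inr p.2), by simp⟩) (by
    constructor
    · rintro ⟨b, j⟩ ⟨b', j'⟩ h
      simpa using h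
    · rintro ⟨e, he⟩
      induction e using Sym2.ind with
      | _ x y =>
        rw [SimpleGraph.mem_edgeSet] at he
        rcases x with b | j <;> rcases y with b' | j'
        · simp at he
        · exact ⟨(b, j'), rfl⟩
        · exact ⟨(b', j), Subtype.ext Sym2.eq_swap⟩
        · simp at he)

theorem endpointCount_mk {V : Type*} [Fintype V] [DecidableEq V] (A : Finset V) {x y : V}
    (hxy : x ≠ y) :
    endpointCount A s(x, y) = (if x ∈ A then 1 else 0) + if y ∈ A then 1 else 0 := by
  have : (A.filter fun v => v ∈ s(x, y)) =
      (if x ∈ A then {x} else ∅) ∪ if y ∈ A then {y} else ∅ := by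
    ext v
    simp only [Finset.mem_filter, Sym2.mem_iff, Finset.mem_union]
    constructor
    · rintro ⟨hv, rfl | rfl⟩ <;> simp [hv]
    · rintro (h | h)
      · split_ifs at h with hx
        · rw [Finset.mem_singleton] at h
          subst h; exact ⟨hx, Or.inl rfl⟩
        · simp at h
      · split_ifs at h with hx
        · rw [Finset.mem_singleton] at h
          subst h; exact ⟨hx, Or.inr rfl⟩
        · simp at h
  rw [endpointCount, this, Finset.card_union_of_disjoint]
  · split_ifs <;> simp
  · split_ifs <;> simp [hxy]

theorem cutVector_edge_zero (p : Bool × Finset (Fin m)) (j : Fin m) :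
    cutVector (completeBipartiteGraph (Fin 2) (Fin m)) (toPartition p) (edgeEquiv (0, j)) =
      if j ∈ p.2 then 1 else 0 := by
  change (if endpointCount (partOf p) s(Sum.inl 0, Sum.inr j) = 1 then (1 : ℤ) else 0) = _
  simp only [endpointCount_mk _ Sum.inl_ne_inr, inl_mem_partOf, inr_mem_partOf]
  by_cases h : j ∈ p.2 <;> simp [h]

theorem cutVector_edge_one (p : Bool × Finset (Fin m)) (j : Fin m) :
    cutVector (completeBipartiteGraph (Fin 2) (Fin m)) (toPartition p) (edgeEquiv (1, j)) =
      if (j ∈ p.2 ↔ p.1 = false) then 1 else 0 := by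
  change (if endpointCount (partOf p) s(Sum.inl 1, Sum.inr j) = 1 then (1 : ℤ) else 0) = _
  simp only [endpointCount_mk _ Sum.inl_ne_inr, inl_mem_partOf, inr_mem_partOf]
  by_cases h : j ∈ p.2 <;> cases h' : p.1 <;> simp [h]

theorem minSize_toPartition (p : Bool × Finset (Fin m)) :
    minSize (toPartition p) =
      min (p.2.card + if p.1 = true then 1 else 0)
        (m + 2 - (p.2.card + if p.1 = true then 1 else 0)) := by
  have hcard : (partOf p).card = p.2.card + if p.1 = true then 1 else 0 := by
    have : partOf p = (Finset.univ.filter fun b : Fin 2 => b = 1 ∧ p.1 = true).disjSum p.2 := by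
      ext v
      rcases v with b | j
      · rw [inl_mem_partOf, Finset.inl_mem_disjSum]; simp
      · rw [inr_mem_partOf, Finset.inr_mem_disjSum]
    rw [this, Finset.card_disjSum, add_comm]
    congr 1
    cases p.1
    · simp
    · simp [Finset.filter_eq']
  change min (partOf p).card (partOf p)ᶜ.card = _
  rw [Finset.card_compl, hcard, Fintype.card_sum, Fintype.card_fin, Fintype.card_fin, add_comm 2 m]

/-- The sets `S` for which the partition `(e, S)` belongs to `B`. -/
def fiber (B : Finset (UnorderedPartition (Fin 2 ⊕ Fin m))) (e : Bool) :
    Finset (Finset (Fin m)) :=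
  Finset.univ.filter fun S => toPartition (e, S) ∈ B

/-- The members of `C` are pairwise comparable. -/
def IsChainFamily (C : Finset (Finset (Fin m))) : Prop :=
  ∀ S ∈ C, ∀ T ∈ C, S ⊆ T ∨ T ⊆ S

/-- The faces of the initial complex: two chains, the second of which does not contain both trivial
subsets. -/
def IsFace (B : Finset (UnorderedPartition (Fin 2 ⊕ Fin m))) : Prop :=
  IsChainFamily (fiber B false) ∧ IsChainFamily (fiber B true) ∧
    ¬ (∅ ∈ fiber B true ∧ Finset.univ ∈ fiber B true)

theorem mem_fiber {B : Finset (UnorderedPartition (Fin 2 ⊕ Fin m))} {e : Bool}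
    {S : Finset (Fin m)} : S ∈ fiber B e ↔ toPartition (e, S) ∈ B := by simp [fiber]

theorem IsChainFamily.mono {C D : Finset (Finset (Fin m))} (hD : IsChainFamily D) (h : C ⊆ D) :
    IsChainFamily C := fun S hS T hT => hD S (h hS) T (h hT)

theorem fiber_mono {B C : Finset (UnorderedPartition (Fin 2 ⊕ Fin m))} (h : B ⊆ C) (e : Bool) :
    fiber B e ⊆ fiber C e := fun _ hS => mem_fiber.mpr (h (mem_fiber.mp hS))

theorem IsFace.mono {B C : Finset (UnorderedPartition (Fin 2 ⊕ Fin m))} (hC : IsFace C)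
    (h : B ⊆ C) : IsFace B :=
  ⟨hC.1.mono (fiber_mono h _), hC.2.1.mono (fiber_mono h _),
    fun hB => hC.2.2 ⟨fiber_mono h _ hB.1, fiber_mono h _ hB.2⟩⟩

/-- The set of partitions with prescribed fibers. -/
def ofFibers (C : Bool → Finset (Finset (Fin m))) :
    Finset (UnorderedPartition (Fin 2 ⊕ Fin m)) :=
  ((Finset.univ.filter fun p : Bool × Finset (Fin m) => p.2 ∈ C p.1)).map toPartition.toEmbedding

theorem fiber_ofFibers (C : Bool → Finset (Finset (Fin m))) (e : Bool) :
    fiber (ofFibers C) e = C e := by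
  ext S
  simp [fiber, ofFibers]

theorem ofFibers_fiber (B : Finset (UnorderedPartition (Fin 2 ⊕ Fin m))) :
    ofFibers (fiber B) = B := by
  ext q
  obtain ⟨p, rfl⟩ := toPartition.surjective q
  simp [fiber, ofFibers]

theorem card_ofFibers (C : Bool → Finset (Finset (Fin m))) :
    (ofFibers C).card = (C false).card + (C true).card := by
  rw [ofFibers, Finset.card_map, Finset.card_filter, Fintype.sum_prod_type, Fintype.sum_bool,
    add_comm, ← Finset.card_filter, ← Finset.card_filter]
  simp

instance : Fintype (UnorderedPartition (Fin 2 ⊕ Fin m)) := Fintype.ofFinite _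

theorem sum_partition {M : Type*} [AddCommMonoid M]
    (f : UnorderedPartition (Fin 2 ⊕ Fin m) → M) :
    ∑ q, f q = ∑ S, f (toPartition (false, S)) + ∑ S, f (toPartition (true, S)) := by
  rw [← Equiv.sum_comp toPartition, Fintype.sum_prod_type, Fintype.sum_bool, add_comm]

/-- The weights of the partitions `(e, S)`. -/
def weightOf (c : UnorderedPartition (Fin 2 ⊕ Fin m) → ℝ) (e : Bool) (S : Finset (Fin m)) : ℝ :=
  c (toPartition (e, S))

theorem mem_fiber_supp {c : UnorderedPartition (Fin 2 ⊕ Fin m) → ℝ} {e : Bool}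
    {S : Finset (Fin m)} : S ∈ fiber (supp c) e ↔ weightOf c e S ≠ 0 := by
  rw [mem_fiber, mem_supp, weightOf]

theorem isFace_supp_iff (c : UnorderedPartition (Fin 2 ⊕ Fin m) → ℝ) :
    IsFace (supp c) ↔ IsChainSupported (weightOf c false) ∧ IsChainSupported (weightOf c true) ∧
      IsAntipodeFree (weightOf c true) := by
  simp only [IsFace, IsChainFamily, mem_fiber_supp, IsChainSupported, IsAntipodeFree,
    not_and_or, not_not]
  refine and_congr ?_ (and_congr ?_ Iff.rfl) <;>
    exact ⟨fun h S T hS hT => h S hS T hT, fun h S hS T hT => h S T hS hT⟩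

/-- The cut vectors of `K_{2,m}`. -/
abbrev cuts (m : ℕ) := cutVector (completeBipartiteGraph (Fin 2) (Fin m))

theorem columnSum_snd_cuts (c : UnorderedPartition (Fin 2 ⊕ Fin m) → ℝ) :
    (columnSum (cuts m) c).2 = ∑ S, weightOf c false S + ∑ S, weightOf c true S := by
  rw [columnSum_snd, sum_partition]
  rfl

theorem columnSum_fst_cuts_zero (c : UnorderedPartition (Fin 2 ⊕ Fin m) → ℝ) (j : Fin m) :
    (columnSum (cuts m) c).1 (edgeEquiv (0, j)) =
      cover (weightOf c false) j + cover (weightOf c true) j := by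
  rw [columnSum_fst, Finset.sum_apply, sum_partition]
  simp [realPoint, cutVector_edge_zero, cover, weightOf]

theorem columnSum_fst_cuts_one (c : UnorderedPartition (Fin 2 ⊕ Fin m) → ℝ) (j : Fin m) :
    (columnSum (cuts m) c).1 (edgeEquiv (1, j)) =
      cover (weightOf c false) j +
        (∑ S, weightOf c true S - cover (weightOf c true) j) := by
  rw [columnSum_fst, Finset.sum_apply, sum_partition]
  congr 1
  · simp [realPoint, cutVector_edge_one, cover, weightOf]
  · rw [cover, ← Finset.sum_sub_distrib]
    refine Finset.sum_congr rfl fun S _ => ?_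
    by_cases h : j ∈ S <;> simp [realPoint, cutVector_edge_one, weightOf, h]

theorem columnSum_cuts_eq_iff (c d : UnorderedPartition (Fin 2 ⊕ Fin m) → ℝ) :
    columnSum (cuts m) c = columnSum (cuts m) d ↔
      (∀ j, cover (weightOf c false) j + cover (weightOf c true) j =
        cover (weightOf d false) j + cover (weightOf d true) j) ∧
      (∀ j, cover (weightOf c false) j + (∑ S, weightOf c true S - cover (weightOf c true) j) =
        cover (weightOf d false) j + (∑ S, weightOf d true S - cover (weightOf d true) j)) ∧
      ∑ S, weightOf c false S + ∑ S, weightOf c true S =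
        ∑ S, weightOf d false S + ∑ S, weightOf d true S := by
  simp only [← columnSum_fst_cuts_zero, ← columnSum_fst_cuts_one, ← columnSum_snd_cuts]
  constructor
  · intro h
    simp [h]
  · rintro ⟨h1, h2, h3⟩
    refine Prod.ext (funext fun e => ?_) h3
    obtain ⟨⟨b, j⟩, rfl⟩ := edgeEquiv.surjective e
    fin_cases b
    exacts [h1 j, h2 j]

theorem weightOf_ext {c d : UnorderedPartition (Fin 2 ⊕ Fin m) → ℝ}
    (h0 : weightOf c false = weightOf d false) (h1 : weightOf c true = weightOf d true) :
    c = d := by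
  funext q
  obtain ⟨⟨e, S⟩, rfl⟩ := toPartition.surjective q
  cases e
  exacts [congrFun h0 S, congrFun h1 S]

/-- The members of the lattice spanned by the columns are integral, and the sums of the two
coordinates at a vertex have the same parity. -/
theorem parity_of_mem_span {x : ((completeBipartiteGraph (Fin 2) (Fin m)).edgeSet → ℝ) × ℝ}
    (hx : x ∈ Submodule.span ℤ (Set.range (column (cuts m)))) :
    (∀ e, ∃ z : ℤ, x.1 e = z) ∧ (∃ z : ℤ, x.2 = z) ∧
      ∀ j k, ∃ z : ℤ, x.1 (edgeEquiv (0, j)) + x.1 (edgeEquiv (1, j)) -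
        (x.1 (edgeEquiv (0, k)) + x.1 (edgeEquiv (1, k))) = 2 * z := by
  induction hx using Submodule.span_induction with
  | mem x hx =>
    obtain ⟨q, rfl⟩ := hx
    obtain ⟨⟨e, S⟩, rfl⟩ := toPartition.surjective q
    refine ⟨fun e => ⟨_, rfl⟩, ⟨1, by simp [column]⟩, fun j k => ?_⟩
    refine ⟨(if e = true then 0 else ((if j ∈ S then 1 else 0) - if k ∈ S then 1 else 0)), ?_⟩
    simp only [column, realPoint, cutVector_edge_zero, cutVector_edge_one]
    by_cases hj : j ∈ S <;> by_cases hk : k ∈ S <;> cases e <;> norm_num [hj, hk]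
  | zero => exact ⟨fun e => ⟨0, by simp⟩, ⟨0, by simp⟩, fun j k => ⟨0, by simp⟩⟩
  | add x y _ _ hx hy =>
    obtain ⟨hx1, ⟨a, ha⟩, hx3⟩ := hx
    obtain ⟨hy1, ⟨b, hb⟩, hy3⟩ := hy
    refine ⟨fun e => ?_, ⟨a + b, by simp [ha, hb]⟩, fun j k => ?_⟩
    · obtain ⟨u, hu⟩ := hx1 e
      obtain ⟨v, hv⟩ := hy1 e
      exact ⟨u + v, by simp [hu, hv]⟩
    · obtain ⟨u, hu⟩ := hx3 j k
      obtain ⟨v, hv⟩ := hy3 j k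
      refine ⟨u + v, ?_⟩
      simp only [Prod.fst_add, Pi.add_apply]
      push_cast
      linarith
  | smul n x _ hx =>
    obtain ⟨hx1, ⟨a, ha⟩, hx3⟩ := hx
    refine ⟨fun e => ?_, ⟨n * a, by simp [ha]⟩, fun j k => ?_⟩
    · obtain ⟨u, hu⟩ := hx1 e
      exact ⟨n * u, by simp [hu]⟩
    · obtain ⟨u, hu⟩ := hx3 j k
      refine ⟨n * u, ?_⟩
      simp only [Prod.smul_fst, Pi.smul_apply]
      simp only [zsmul_eq_mul]
      push_cast
      linear_combination (n : ℝ) * hu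

theorem properPart_isProperChain {C : Finset (Finset (Fin m))} (hC : IsChainFamily C) :
    IsProperChain (C \ {∅, Finset.univ}) := by
  refine ⟨fun S hS => ?_, fun S hS T hT =>
    hC S (Finset.mem_sdiff.mp hS).1 T (Finset.mem_sdiff.mp hT).1⟩
  simpa using (Finset.mem_sdiff.mp hS).2

/-- The maximal chain of the initial segments of `w`. -/
def maximalChain (w : Equiv.Perm (Fin m)) : Finset (Finset (Fin m)) :=
  insert ∅ (Finset.univ.image (initialSegment w))

theorem isChainFamily_maximalChain (w : Equiv.Perm (Fin m)) : IsChainFamily (maximalChain w) := by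
  intro S hS T hT
  rcases Finset.mem_insert.mp hS with rfl | hS
  · exact Or.inl (Finset.empty_subset _)
  rcases Finset.mem_insert.mp hT with rfl | hT
  · exact Or.inr (Finset.empty_subset _)
  obtain ⟨i, -, rfl⟩ := Finset.mem_image.mp hS
  obtain ⟨j, -, rfl⟩ := Finset.mem_image.mp hT
  refine (le_total i j).imp (fun h x hx => ?_) fun h x hx => ?_ <;>
    rw [mem_initialSegment] at hx ⊢ <;> exact hx.trans h

theorem card_maximalChain (w : Equiv.Perm (Fin m)) : (maximalChain w).card = m + 1 := by
  rw [maximalChain, Finset.card_insert_of_notMem,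
    Finset.card_image_of_injective _ (initialSegment_injective w)]
  · simp
  · intro h
    obtain ⟨i, -, hi⟩ := Finset.mem_image.mp h
    have := card_initialSegment w i
    simp [hi] at this

theorem univ_mem_maximalChain [NeZero m] (w : Equiv.Perm (Fin m)) :
    Finset.univ ∈ maximalChain w := by
  refine Finset.mem_insert_of_mem (Finset.mem_image.mpr ⟨⟨m - 1, ?_⟩, Finset.mem_univ _, ?_⟩)
  · have := NeZero.pos m
    omega
  · rw [← Finset.card_eq_iff_eq_univ, card_initialSegment, Fintype.card_fin]
    have := NeZero.pos m
    simp only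
    omega

theorem exists_subset_maximalChain [NeZero m] {C : Finset (Finset (Fin m))}
    (hC : IsChainFamily C) : ∃ w, C ⊆ maximalChain w := by
  have hp := properPart_isProperChain hC
  refine ⟨chainPerm (C \ {∅, Finset.univ}), fun S hS => ?_⟩
  by_cases h0 : S = ∅
  · rw [h0]; exact Finset.mem_insert_self _ _
  by_cases h1 : S = Finset.univ
  · rw [h1]; exact univ_mem_maximalChain _
  have hS' : S ∈ C \ {∅, Finset.univ} := by simp [hS, h0, h1]
  obtain ⟨i, hi, -⟩ := exists_card_eq hp hS'
  exact Finset.mem_insert_of_mem (Finset.mem_image.mpr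
    ⟨i, Finset.mem_univ _, (eq_initialSegment_chainPerm hp hS' hi).symm⟩)

theorem exists_antipodeFree_extension [NeZero m] {C : Finset (Finset (Fin m))}
    (hC : IsChainFamily C) (hC' : ¬ (∅ ∈ C ∧ Finset.univ ∈ C)) :
    ∃ D, C ⊆ D ∧ IsChainFamily D ∧ ¬ (∅ ∈ D ∧ Finset.univ ∈ D) ∧ D.card = m := by
  obtain ⟨w, hw⟩ := exists_subset_maximalChain hC
  by_cases h0 : ∅ ∈ C
  · have h1 : Finset.univ ∉ C := fun h1 => hC' ⟨h0, h1⟩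
    refine ⟨(maximalChain w).erase Finset.univ, fun S hS => Finset.mem_erase.mpr
      ⟨fun h => h1 (h ▸ hS), hw hS⟩, (isChainFamily_maximalChain w).mono (Finset.erase_subset _ _),
      by simp, ?_⟩
    rw [Finset.card_erase_of_mem (univ_mem_maximalChain w), card_maximalChain]
    rfl
  · refine ⟨(maximalChain w).erase ∅, fun S hS => Finset.mem_erase.mpr
      ⟨fun h => h0 (h ▸ hS), hw hS⟩, (isChainFamily_maximalChain w).mono (Finset.erase_subset _ _),
      by simp, ?_⟩
    rw [Finset.card_erase_of_mem (by exact Finset.mem_insert_self _ _), card_maximalChain]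
    rfl

theorem card_edgeSet [Fintype (completeBipartiteGraph (Fin 2) (Fin m)).edgeSet] :
    Fintype.card (completeBipartiteGraph (Fin 2) (Fin m)).edgeSet = 2 * m := by
  rw [← Fintype.card_congr edgeEquiv]
  simp

theorem isUnimodularSystem_cuts [NeZero m]
    [Fintype (completeBipartiteGraph (Fin 2) (Fin m)).edgeSet] :
    IsUnimodularSystem (cuts m) IsFace where
  zero_or_one q e := by
    obtain ⟨p, rfl⟩ := toPartition.surjective q
    obtain ⟨⟨b, j⟩, rfl⟩ := edgeEquiv.surjective e
    fin_cases b
    · change cuts m _ (edgeEquiv (0, j)) = 0 ∨ cuts m _ (edgeEquiv (0, j)) = 1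
      rw [cuts, cutVector_edge_zero]
      split_ifs <;> simp
    · change cuts m _ (edgeEquiv (1, j)) = 0 ∨ cuts m _ (edgeEquiv (1, j)) = 1
      rw [cuts, cutVector_edge_one]
      split_ifs <;> simp
  down_closed hB hC := hB.mono hC
  unique := by
    intro c d hc hd hcF hdF h
    rw [isFace_supp_iff] at hcF hdF
    rw [columnSum_cuts_eq_iff] at h
    obtain ⟨h0, h1⟩ := pair_unique (fun S => hc _) (fun S => hc _) (fun S => hd _) (fun S => hd _)
      hcF.1 hcF.2.1 hdF.1 hdF.2.1 hcF.2.2 hdF.2.2 h.1 h.2.1 h.2.2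
    exact weightOf_ext h0 h1
  exists_rep := by
    intro c hc
    obtain ⟨d, d', hd, hd', hdc, hdc', hda, h1, h2, h3⟩ := pair_exists
      (c := weightOf c false) (c' := weightOf c true) (fun S => hc _) (fun S => hc _)
    let D : UnorderedPartition (Fin 2 ⊕ Fin m) → ℝ := fun q =>
      if (toPartition.symm q).1 = true then d' (toPartition.symm q).2 else d (toPartition.symm q).2
    have hD0 : weightOf D false = d := by funext S; simp [weightOf, D]
    have hD1 : weightOf D true = d' := by funext S; simp [weightOf, D]
    refine ⟨D, fun q => ?_, ?_, ?_⟩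
    · simp only [D]
      split_ifs
      exacts [hd' _, hd _]
    · rw [isFace_supp_iff, hD0, hD1]
      exact ⟨hdc, hdc', hda⟩
    · rw [columnSum_cuts_eq_iff, hD0, hD1]
      exact ⟨h1, h2, h3⟩
  integral := by
    intro c hc hF hmem q
    rw [isFace_supp_iff] at hF
    obtain ⟨h1, h2, h3⟩ := parity_of_mem_span hmem
    rw [columnSum_snd_cuts] at h2
    have h10 (j : Fin m) := h1 (edgeEquiv (0, j))
    have h11 (j : Fin m) := h1 (edgeEquiv (1, j))
    simp only [columnSum_fst_cuts_zero, columnSum_fst_cuts_one] at h10 h11 h3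
    obtain ⟨hi0, hi1⟩ := pair_int (fun S => hc _) (fun S => hc _) hF.1 hF.2.1 hF.2.2 h10 h3 h11 h2
    obtain ⟨⟨e, S⟩, rfl⟩ := toPartition.surjective q
    cases e
    exacts [hi0 S, hi1 S]
  pure := by
    rintro B ⟨h0, h1, h2⟩
    obtain ⟨w, hw⟩ := exists_subset_maximalChain h0
    obtain ⟨D, hD, hDc, hDa, hDm⟩ := exists_antipodeFree_extension h1 h2
    refine ⟨ofFibers fun e => bif e then D else maximalChain w, ?_, ?_, ?_⟩
    · conv_lhs => rw [← ofFibers_fiber B]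
      refine Finset.map_subset_map.mpr fun p hp => ?_
      rw [Finset.mem_filter] at hp ⊢
      refine ⟨hp.1, ?_⟩
      obtain ⟨e, S⟩ := p
      cases e
      exacts [hw hp.2, hD hp.2]
    · simp only [IsFace, fiber_ofFibers]
      exact ⟨isChainFamily_maximalChain w, hDc, hDa⟩
    · rw [card_ofFibers, card_edgeSet]
      simp only [cond_false, cond_true, card_maximalChain, hDm]
      omega

end CutPolytope

/-! ### Reduction of nonfaces in the reverse lexicographic order -/

open scoped MonomialOrder

theorem degRevLex_pair_lt {σ : Type*} [LinearOrder σ] [Finite σ] {s t s' t' r : σ}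
    (hr : r = s' ∨ r = t') (hrs : r < s) (hrt : r < t) :
    (Finsupp.single s' 1 + Finsupp.single t' 1 : σ →₀ ℕ) ≺[degRevLex σ]
      (Finsupp.single s 1 + Finsupp.single t 1) := by
  classical
  rw [degRevLex_lt_iff]
  have hle : min s' t' ≤ r := by
    rcases hr with rfl | rfl
    exacts [min_le_left _ _, min_le_right _ _]
  refine Or.inr ⟨by simp only [map_add, Finsupp.degree_single], min s' t', fun j hj => ?_, ?_⟩
  · have h1 := lt_min_iff.mp hj
    have h2 := hj.trans_le hle
    simp [h1.1.ne', h1.2.ne', (h2.trans hrs).ne', (h2.trans hrt).ne']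
  · have h3 : Finsupp.single s 1 (min s' t') = 0 :=
      Finsupp.single_eq_of_ne (hle.trans_lt hrs).ne
    have h4 : Finsupp.single t 1 (min s' t') = 0 :=
      Finsupp.single_eq_of_ne (hle.trans_lt hrt).ne
    rw [Finsupp.add_apply, Finsupp.add_apply, h3, h4]
    rcases min_choice s' t' with h | h <;> rw [h] <;> simp

theorem exists_smaller_of_pair {σ M : Type*} [LinearOrder σ] [Finite σ] [AddCommGroup M]
    {A : σ → M} {B : Finset σ} {s t s' t' r : σ} (hs : s ∈ B) (ht : t ∈ B) (hst : s ≠ t)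
    (hA : A s' + A t' = A s + A t) (hr : r = s' ∨ r = t') (hrs : r < s) (hrt : r < t) :
    ∃ v, monomialWeight A v = monomialWeight A (squarefreeExponent B) ∧
      v ≺[degRevLex σ] squarefreeExponent B := by
  have hB : squarefreeExponent B =
      (Finsupp.single s 1 + Finsupp.single t 1) + squarefreeExponent ((B.erase s).erase t) := by
    rw [squarefreeExponent, ← Finset.add_sum_erase _ _ hs,
      ← Finset.add_sum_erase _ _ (Finset.mem_erase.mpr ⟨hst.symm, ht⟩), ← add_assoc]
    rfl
  refine ⟨(Finsupp.single s' 1 + Finsupp.single t' 1) +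
    squarefreeExponent ((B.erase s).erase t), ?_, ?_⟩
  · rw [hB]
    simp only [map_add, monomialWeight_single, hA]
  · rw [hB, map_add, map_add (degRevLex σ).toSyn (Finsupp.single s 1 + Finsupp.single t 1)]
    exact add_lt_add_left (degRevLex_pair_lt hr hrs hrt) _

namespace CutPolytope

open scoped Classical
open LatticePolytope EulerianChain

variable {m : ℕ}

theorem cuts_add_inter_union (e : Bool) (S T : Finset (Fin m)) :
    ((cuts m (toPartition (e, S ∩ T)), (1 : ℤ)) + (cuts m (toPartition (e, S ∪ T)), (1 : ℤ))) =
      (cuts m (toPartition (e, S)), (1 : ℤ)) + (cuts m (toPartition (e, T)), (1 : ℤ)) := by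
  refine Prod.ext (funext fun x => ?_) rfl
  obtain ⟨⟨b, j⟩, rfl⟩ := edgeEquiv.surjective x
  have h0 (p : Bool × Finset (Fin m)) := cutVector_edge_zero p j
  have h1 (p : Bool × Finset (Fin m)) := cutVector_edge_one p j
  fin_cases b <;> by_cases hS : j ∈ S <;> by_cases hT : j ∈ T <;> cases e <;>
    simp [h0, h1, hS, hT]

theorem cuts_add_empty_univ :
    ((cuts m (toPartition (false, ∅)), (1 : ℤ)) +
        (cuts m (toPartition (false, Finset.univ)), (1 : ℤ))) =
      (cuts m (toPartition (true, ∅)), (1 : ℤ)) +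
        (cuts m (toPartition (true, Finset.univ)), (1 : ℤ)) := by
  refine Prod.ext (funext fun x => ?_) rfl
  obtain ⟨⟨b, j⟩, rfl⟩ := edgeEquiv.surjective x
  have h0 (p : Bool × Finset (Fin m)) := cutVector_edge_zero p j
  have h1 (p : Bool × Finset (Fin m)) := cutVector_edge_one p j
  fin_cases b <;> simp [h0, h1]

theorem exists_smaller_of_not_isFace [NeZero m]
    [LinearOrder (UnorderedPartition (Fin 2 ⊕ Fin m))]
    (hlt : ∀ p q : UnorderedPartition (Fin 2 ⊕ Fin m), minSize p < minSize q → p < q)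
    (B : Finset (UnorderedPartition (Fin 2 ⊕ Fin m))) (hB : ¬ IsFace B) :
    ∃ v, monomialWeight (fun s => (cuts m s, (1 : ℤ))) v =
      monomialWeight (fun s => (cuts m s, (1 : ℤ))) (squarefreeExponent B) ∧
        v ≺[degRevLex (UnorderedPartition (Fin 2 ⊕ Fin m))] squarefreeExponent B := by
  have hchain (e : Bool) (h : ¬ IsChainFamily (fiber B e)) :
      ∃ v, monomialWeight (fun s => (cuts m s, (1 : ℤ))) v =
        monomialWeight (fun s => (cuts m s, (1 : ℤ))) (squarefreeExponent B) ∧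
          v ≺[degRevLex (UnorderedPartition (Fin 2 ⊕ Fin m))] squarefreeExponent B := by
    simp only [IsChainFamily, not_forall, not_or] at h
    obtain ⟨S, hS, T, hT, hST, hTS⟩ := h
    have h1 : (S ∩ T).card < S.card := Finset.card_lt_card
      ⟨Finset.inter_subset_left, fun h => hST fun x hx => (Finset.mem_inter.mp (h hx)).2⟩
    have h2 : (S ∩ T).card < T.card := Finset.card_lt_card
      ⟨Finset.inter_subset_right, fun h => hTS fun x hx => (Finset.mem_inter.mp (h hx)).1⟩
    have h3 := Finset.card_union_add_card_inter S T
    have h4 : (S ∪ T).card ≤ m := (Finset.card_le_univ _).trans (by simp)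
    have hne : toPartition (e, S) ≠ toPartition (e, T) := fun h => by
      have := (Prod.ext_iff.mp (toPartition.injective h)).2
      exact hST (le_of_eq this)
    by_cases hc : minSize (toPartition (e, S ∩ T)) < minSize (toPartition (e, S)) ∧
        minSize (toPartition (e, S ∩ T)) < minSize (toPartition (e, T))
    · exact exists_smaller_of_pair (mem_fiber.mp hS) (mem_fiber.mp hT) hne
        (cuts_add_inter_union e S T) (Or.inl rfl) (hlt _ _ hc.1) (hlt _ _ hc.2)
    · refine exists_smaller_of_pair (mem_fiber.mp hS) (mem_fiber.mp hT) hne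
        (cuts_add_inter_union e S T) (Or.inr rfl) (hlt _ _ ?_) (hlt _ _ ?_) <;>
      · simp only [minSize_toPartition] at hc ⊢
        cases e <;> simp at hc ⊢ <;> omega
  by_cases h0 : IsChainFamily (fiber B false)
  · by_cases h1 : IsChainFamily (fiber B true)
    · obtain ⟨he, hu⟩ : ∅ ∈ fiber B true ∧ Finset.univ ∈ fiber B true := by
        by_contra h
        exact hB ⟨h0, h1, h⟩
      have hm := NeZero.pos m
      refine exists_smaller_of_pair (mem_fiber.mp he) (mem_fiber.mp hu) (fun h => ?_)
        cuts_add_empty_univ (Or.inl rfl) (hlt _ _ ?_) (hlt _ _ ?_)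
      · have := congrArg Finset.card (Prod.ext_iff.mp (toPartition.injective h)).2
        simp at this
        omega
      · simp [minSize_toPartition]
      · simp [minSize_toPartition]
    · exact hchain true h1
  · exact hchain false h0

/-! ### The `h`-polynomial -/

theorem card_properChain_le {C : Finset (Finset (Fin m))} (hC : IsProperChain C) :
    C.card ≤ m - 1 := by
  rw [← image_initialSegment_chainPerm hC, ← card_positions]
  exact Finset.card_image_le.trans (Finset.card_le_card (chainPositions_subset hC))

theorem isChainFamily_union {D E : Finset (Finset (Fin m))} (hD : IsProperChain D)
    (hE : E ⊆ {∅, Finset.univ}) : IsChainFamily (D ∪ E) := by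
  intro S hS T hT
  rcases Finset.mem_union.mp hS with hS | hS
  · rcases Finset.mem_union.mp hT with hT | hT
    · exact hD.2 S hS T hT
    · have := hE hT
      simp only [Finset.mem_insert, Finset.mem_singleton] at this
      rcases this with rfl | rfl
      exacts [Or.inr (Finset.empty_subset _), Or.inl (Finset.subset_univ _)]
  · have := hE hS
    simp only [Finset.mem_insert, Finset.mem_singleton] at this
    rcases this with rfl | rfl
    exacts [Or.inl (Finset.empty_subset _), Or.inr (Finset.subset_univ _)]

theorem properChain_disjoint {D E : Finset (Finset (Fin m))} (hD : IsProperChain D)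
    (hE : E ⊆ {∅, Finset.univ}) : Disjoint D E := by
  rw [Finset.disjoint_left]
  intro S hS hS'
  have := hE hS'
  simp only [Finset.mem_insert, Finset.mem_singleton] at this
  exact this.elim (hD.1 S hS).1 (hD.1 S hS).2

/-- The chains whose trivial members form a set of the family `Q` are the unions of a chain of
proper subsets and a member of `Q`. -/
theorem sum_chainFamily_eq (Q : Finset (Finset (Finset (Fin m)))) (r : ℕ)
    (hQ : ∀ E ∈ Q, E ⊆ {∅, Finset.univ}) (hr : ∀ E ∈ Q, E.card ≤ r) :
    ∑ C ∈ Finset.univ.filter fun C : Finset (Finset (Fin m)) =>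
        IsChainFamily C ∧ C ∩ {∅, Finset.univ} ∈ Q,
      (X : ℤ[X]) ^ C.card * (1 - X) ^ (m - 1 + r - C.card) =
    eulerianPolynomial m * ∑ E ∈ Q, X ^ E.card * (1 - X) ^ (r - E.card) := by
  rw [← sum_properChain_eq, Finset.sum_mul_sum, ← Finset.sum_product']
  have hsplit {D E : Finset (Finset (Fin m))} (hD : IsProperChain D)
      (hE : E ⊆ {∅, Finset.univ}) :
      (D ∪ E) \ {∅, Finset.univ} = D ∧ (D ∪ E) ∩ {∅, Finset.univ} = E := by
    have h1 := properChain_disjoint hD (Finset.Subset.refl {∅, Finset.univ})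
    constructor
    · rw [Finset.union_sdiff_distrib, Finset.sdiff_eq_self_of_disjoint h1,
        Finset.sdiff_eq_empty_iff_subset.mpr hE, Finset.union_empty]
    · rw [Finset.union_inter_distrib_right, Finset.disjoint_iff_inter_eq_empty.mp h1,
        Finset.empty_union, Finset.inter_eq_left.mpr hE]
  refine Finset.sum_bij' (fun C _ => (C \ {∅, Finset.univ}, C ∩ {∅, Finset.univ}))
    (fun p _ => p.1 ∪ p.2) ?_ ?_ ?_ ?_ ?_
  · intro C hC
    obtain ⟨h1, h2⟩ := (Finset.mem_filter.mp hC).2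
    simpa [h2] using properPart_isProperChain h1
  · rintro ⟨D, E⟩ h
    simp only [Finset.mem_product, Finset.mem_filter, Finset.mem_univ, true_and] at h ⊢
    rw [(hsplit h.1 (hQ E h.2)).2]
    exact ⟨isChainFamily_union h.1 (hQ E h.2), h.2⟩
  · intro C _
    exact Finset.sdiff_union_inter _ _
  · rintro ⟨D, E⟩ h
    simp only [Finset.mem_product, Finset.mem_filter, Finset.mem_univ, true_and] at h
    exact Prod.ext (hsplit h.1 (hQ E h.2)).1 (hsplit h.1 (hQ E h.2)).2
  · intro C hC
    obtain ⟨h1, h2⟩ := (Finset.mem_filter.mp hC).2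
    have h3 := card_properChain_le (properPart_isProperChain h1)
    have h4 := hr _ h2
    have h5 := Finset.card_sdiff_add_card_inter C {∅, Finset.univ}
    rw [show (X : ℤ[X]) ^ (C \ {∅, Finset.univ}).card *
          (1 - X) ^ (m - 1 - (C \ {∅, Finset.univ}).card) *
          (X ^ (C ∩ {∅, Finset.univ}).card * (1 - X) ^ (r - (C ∩ {∅, Finset.univ}).card)) =
        X ^ ((C \ {∅, Finset.univ}).card + (C ∩ {∅, Finset.univ}).card) *
          (1 - X) ^ ((m - 1 - (C \ {∅, Finset.univ}).card) +
            (r - (C ∩ {∅, Finset.univ}).card)) by rw [pow_add, pow_add]; ring, h5]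
    congr 2
    omega

theorem empty_ne_univ [NeZero m] : (∅ : Finset (Fin m)) ≠ Finset.univ := by
  intro h
  have := congrArg Finset.card h
  have hm := NeZero.pos m
  simp at this
  omega

theorem sum_chainFamily [NeZero m] :
    ∑ C ∈ Finset.univ.filter fun C : Finset (Finset (Fin m)) => IsChainFamily C,
      (X : ℤ[X]) ^ C.card * (1 - X) ^ (m + 1 - C.card) = eulerianPolynomial m := by
  have hm := NeZero.pos m
  have hc : ({∅, Finset.univ} : Finset (Finset (Fin m))).card = 2 :=
    Finset.card_pair empty_ne_univ
  have h := sum_chainFamily_eq (m := m) ({∅, Finset.univ} : Finset (Finset (Fin m))).powerset 2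
    (fun E hE => Finset.mem_powerset.mp hE)
    (fun E hE => hc ▸ Finset.card_le_card (Finset.mem_powerset.mp hE))
  have h2 := Finset.sum_pow_mul_eq_add_pow (X : ℤ[X]) (1 - X)
    ({∅, Finset.univ} : Finset (Finset (Fin m)))
  rw [hc] at h2
  rw [h2, add_sub_cancel, one_pow, mul_one, show m - 1 + 2 = m + 1 by omega] at h
  rw [← h]
  refine Finset.sum_congr ?_ fun _ _ => rfl
  ext C
  simp

theorem sum_antipodeFree [NeZero m] :
    ∑ C ∈ Finset.univ.filter fun C : Finset (Finset (Fin m)) =>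
        IsChainFamily C ∧ ¬ (∅ ∈ C ∧ Finset.univ ∈ C),
      (X : ℤ[X]) ^ C.card * (1 - X) ^ (m - C.card) = eulerianPolynomial m * (X + 1) := by
  have hm := NeZero.pos m
  have hne := empty_ne_univ (m := m)
  have h := sum_chainFamily_eq (m := m) {∅, {∅}, {Finset.univ}} 1
    (fun E hE => by
      simp only [Finset.mem_insert, Finset.mem_singleton] at hE
      rcases hE with rfl | rfl | rfl <;> simp)
    (fun E hE => by
      simp only [Finset.mem_insert, Finset.mem_singleton] at hE
      rcases hE with rfl | rfl | rfl <;> simp)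
  rw [Finset.sum_insert (by simp), Finset.sum_insert (by simpa using hne), Finset.sum_singleton,
    show m - 1 + 1 = m by omega] at h
  have h1 : (X : ℤ[X]) ^ (∅ : Finset (Finset (Fin m))).card *
        (1 - X) ^ (1 - (∅ : Finset (Finset (Fin m))).card) +
      (X ^ ({∅} : Finset (Finset (Fin m))).card *
          (1 - X) ^ (1 - ({∅} : Finset (Finset (Fin m))).card) +
        X ^ ({Finset.univ} : Finset (Finset (Fin m))).card *
          (1 - X) ^ (1 - ({Finset.univ} : Finset (Finset (Fin m))).card)) = X + 1 := by
    simp [add_comm]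
  rw [h1] at h
  rw [← h]
  refine Finset.sum_congr ?_ fun _ _ => rfl
  ext C
  simp only [Finset.mem_filter, Finset.mem_univ, true_and, Finset.mem_insert,
    Finset.mem_singleton]
  refine and_congr_right fun _ => ?_
  have hpair : ({∅, Finset.univ} : Finset (Finset (Fin m))) ≠ {∅} := fun h => by
    simpa [Finset.card_pair hne] using congrArg Finset.card h
  by_cases h0 : ∅ ∈ C <;> by_cases h1 : Finset.univ ∈ C <;>
    simp [h0, h1, hne, hpair, Finset.inter_insert_of_mem, Finset.inter_insert_of_notMem,
      Finset.inter_singleton_of_mem, Finset.inter_singleton_of_notMem]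

theorem sum_isFace [NeZero m] :
    ∑ B ∈ Finset.univ.filter (IsFace : Finset (UnorderedPartition (Fin 2 ⊕ Fin m)) → Prop),
      (X : ℤ[X]) ^ B.card * (1 - X) ^ (2 * m + 1 - B.card) =
    (X + 1) * eulerianPolynomial m ^ 2 := by
  rw [show (X + 1) * eulerianPolynomial m ^ 2 =
    eulerianPolynomial m * (eulerianPolynomial m * (X + 1)) by ring, ← sum_antipodeFree]
  nth_rewrite 1 [← sum_chainFamily]
  rw [Finset.sum_mul_sum, ← Finset.sum_product']
  have hcard0 {C : Finset (Finset (Fin m))} (hC : IsChainFamily C) : C.card ≤ m + 1 := by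
    obtain ⟨w, hw⟩ := exists_subset_maximalChain hC
    exact card_maximalChain w ▸ Finset.card_le_card hw
  have hcard1 {C : Finset (Finset (Fin m))} (hC : IsChainFamily C)
      (hC' : ¬ (∅ ∈ C ∧ Finset.univ ∈ C)) : C.card ≤ m := by
    obtain ⟨D, hD, -, -, hDm⟩ := exists_antipodeFree_extension hC hC'
    exact (Finset.card_le_card hD).trans hDm.le
  refine Finset.sum_bij' (fun B _ => (fiber B false, fiber B true))
    (fun p _ => ofFibers fun e => bif e then p.2 else p.1) ?_ ?_ ?_ ?_ ?_
  · intro B hB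
    have hB := (Finset.mem_filter.mp hB).2
    simp only [Finset.mem_product, Finset.mem_filter, Finset.mem_univ, true_and]
    exact ⟨hB.1, hB.2⟩
  · rintro ⟨C, D⟩ h
    simp only [Finset.mem_product, Finset.mem_filter, Finset.mem_univ, true_and] at h ⊢
    simp only [IsFace, fiber_ofFibers]
    exact h
  · intro B _
    conv_rhs => rw [← ofFibers_fiber B]
    congr 1
    funext e
    cases e <;> rfl
  · rintro ⟨C, D⟩ _
    simp only [fiber_ofFibers, cond_false, cond_true]
  · intro B hB
    have hB := (Finset.mem_filter.mp hB).2
    have h0 := hcard0 hB.1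
    have h1 := hcard1 hB.2.1 hB.2.2
    have h2 : B.card = (fiber B false).card + (fiber B true).card := by
      conv_lhs => rw [← ofFibers_fiber B]
      exact card_ofFibers _
    rw [h2, pow_add, show 2 * m + 1 - ((fiber B false).card + (fiber B true).card) =
      (m + 1 - (fiber B false).card) + (m - (fiber B true).card) by omega, pow_add]
    ring

end CutPolytope

end

open scoped Classical in
theorem mainTheorem1 (K : Type*) [Field K] (n : ℕ) (hn : 4 ≤ n)
    [LinearOrder (CutPolytope.UnorderedPartition (Fin 2 ⊕ Fin (n - 2)))]
    (hlt : ∀ p q : CutPolytope.UnorderedPartition (Fin 2 ⊕ Fin (n - 2)),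
      CutPolytope.minSize p < CutPolytope.minSize q → p < q) :
    let G : SimpleGraph (Fin 2 ⊕ Fin (n - 2)) := completeBipartiteGraph (Fin 2) (Fin (n - 2))
    let P : Set (G.edgeSet → ℝ) := CutPolytope.cutPolytope G
    let Δ : Set (Set (G.edgeSet → ℝ)) :=
      initialComplex K (degRevLex (CutPolytope.UnorderedPartition (Fin 2 ⊕ Fin (n - 2))))
        (CutPolytope.cutVector G)
    LatticePolytope.IsUnimodularTriangulation P Δ ∧
    LatticePolytope.hStar P = (LatticePolytope.hPolynomial P Δ : PowerSeries ℤ) ∧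
    LatticePolytope.hPolynomial P Δ =
      (Polynomial.X + 1) * eulerianPolynomial (n - 2) ^ 2 ∧
    LatticePolytope.normalizedVolume P =
      (((LatticePolytope.hPolynomial P Δ).eval 1 : ℤ) : ℝ) ∧
    LatticePolytope.normalizedVolume P = 2 * ((n - 2).factorial : ℝ) ^ 2 := by
  intro G P Δ
  have : NeZero (n - 2) := ⟨by omega⟩
  have hsys := CutPolytope.isUnimodularSystem_cuts (m := n - 2)
  have : Nonempty (completeBipartiteGraph (Fin 2) (Fin (n - 2))).edgeSet :=
    ⟨CutPolytope.edgeEquiv (0, 0)⟩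
  have hΔ : Δ = LatticePolytope.faceComplex (CutPolytope.cuts (n - 2)) CutPolytope.IsFace :=
    hsys.initialComplex_eq _ (CutPolytope.exists_smaller_of_not_isFace hlt)
  have hP : P = convexHull ℝ (Set.range (LatticePolytope.realPoint (CutPolytope.cuts (n - 2)))) :=
    rfl
  have hpoly : LatticePolytope.hPolynomial P Δ =
      (Polynomial.X + 1) * eulerianPolynomial (n - 2) ^ 2 := by
    rw [hΔ, hP, hsys.hPolynomial_eq, CutPolytope.card_edgeSet]
    exact CutPolytope.sum_isFace
  have hvol : LatticePolytope.normalizedVolume P =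
      (((LatticePolytope.hPolynomial P Δ).eval 1 : ℤ) : ℝ) := by
    rw [hΔ, hP, hsys.hPolynomial_eval_one, hsys.normalizedVolume_eq_card]
    rfl
  refine ⟨?_, ?_, hpoly, hvol, ?_⟩
  · rw [hΔ, hP]
    exact hsys.isUnimodularTriangulation
  · rw [hΔ, hP]
    exact hsys.hStar_eq
  · rw [hvol, hpoly]
    simp only [Polynomial.eval_mul, Polynomial.eval_add, Polynomial.eval_X, Polynomial.eval_one,
      Polynomial.eval_pow, EulerianChain.eulerianPolynomial_eval_one]
    push_cast
    ring
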